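/- **Notation.** For $x\in\mathbb R$ let $\|x\|$ be the distance from $x$ to the nearest integer, and for $\mathbf m\in\mathbb R^d$ let $H(\mathbf m)=\prod_{i\le d}\max\{1,|m_i|\}$. For $f:\mathbb R\to\mathbb R$ let $\widehat f(\xi)=\int_{\mathbb R} f(x)e^{-2\pi i\xi x}\,dx$. Let $d\ge 1$, $k=d+1$, and for an integer $\ell\ge 0$ let $\mathcal G_{k,\ell}$ be the set of $\boldsymbol\omega=(\omega_1,\dots,\omega_k)$ such that each $\omega_i:\mathbb R\to[0,\infty)$ is $\ell$ times continuously differentiable, is supported in $[-2,2]$, and satisfies $\widehat\omega_i\ge 0$ (real and non-negative everywhere) and $\widehat\omega_i(0)>0$. For $\boldsymbol\omega\in\mathcal G_{k,\ell}$, $\boldsymbol\alpha\in\mathbb R^d$, $N>0$, $\boldsymbol\gamma\in\mathbb R^d$ and $\boldsymbol\rho\in(0,1/2)^d$ put $$D_{\boldsymbol\omega}(\boldsymbol\gamma,\boldsymbol\rho;N)=\sum_{\mathbf a\in\mathbb Z^k}\omega_k\Big(\frac{a_k}{N}\Big)\prod_{i\le d}\omega_i\Big(\frac{a_i+a_k\alpha_i-\gamma_i}{\rho_i}\Big)-\widehat\omega_1(0)\cdots\widehat\omega_k(0)\,\rho_1\cdots\rho_d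 N,$$ and define the $C^\ell$-smooth discrepancy of the Kronecker sequence $(n\boldsymbol\alpha \bmod 1)_{n\ge1}$ to be $$D_{\boldsymbol\omega}(\boldsymbol\alpha;N)=\sup_{\boldsymbol\gamma\in\mathbb R^d,\ \boldsymbol\rho\in(0,1/2)^d}|D_{\boldsymbol\omega}(\boldsymbol\gamma,\boldsymbol\rho;N)|\in[0,\infty].$$ For a non-decreasing function $\phi:[1,\infty)\to[1,\infty)$ and $x\ge\phi(1)$ let $L(x)\in[1,x]$ be the value of $H$ such that $H\phi(H)=x$; if $\phi$ is discontinuous and there is no such $H$, put $L(x)=\sup\{H\ge 1: H\phi(H)\le x\}$ (the two agree when the former exists). **Theorem.** Let $d\ge 1$, $\boldsymbol\alpha\in\mathbb R^d$, and let $\phi:[1,\infty)\to[1,\infty)$ be a non-decreasing function such that $$\|\mathbf m\cdot\boldsymbol\alpha\|>\frac{1}{H(\mathbf m)\,\phi(H(\mathbf m))}\qquad(\mathbf 0\ne\mathbf m\in\mathbb Z^d)$$ and $$\xi:=\limsup_{x\to\infty}\frac{\phi(2x)}{\phi(x)}<\infty.$$ Let $\boldsymbol\omega\in\mathcal G_{k,\ell}$,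 where $\ell>2+2\,\frac{\log\xi}{\log 2}$. Then there is a constant $C>0$, which may depend on $d,\boldsymbol\alpha,\phi,\ell,\boldsymbol\omega$ but not on $N$, such that $$D_{\boldsymbol\omega}(\boldsymbol\alpha;N)\le C\,\phi(L(N))\qquad\text{for all real } N\ge\phi(1).$$ In particular, if $d=1$ and $\alpha\in\mathbb R$ is badly approximable, i.e. $\inf_{n\ge1}n\|n\alpha\|>0$, and if $\boldsymbol\omega\in\mathcal G_{2,\ell}$ with $\ell\ge3$, then $D_{\boldsymbol\omega}(\alpha;N)$ is bounded over all real $N\ge1$. -/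

import Mathlib

open scoped FourierTransform

namespace SmoothDisc

/-- `‖x‖`, the distance from the real number `x` to a nearest integer. -/
noncomputable def distInt (x : ℝ) : ℝ := |x - round x|

theorem distInt_le (x : ℝ) (a : ℤ) : distInt x ≤ |x - a| := round_le x a

/-- The multiplicative height `H(m) = ∏ max {1, |m_i|}`. -/
noncomputable def mulHeight {d : ℕ} (m : Fin d → ℝ) : ℝ := ∏ i, max 1 |m i|

/-- The Fourier transform `ξ ↦ ∫ f(x) e(-ξ x) dx`, with `e(z) = exp(2 π i z)`,
of a real function. -/
noncomputable def realFourier (f : ℝ → ℝ) : ℝ → ℂ := 𝓕 (fun x : ℝ => (f x : ℂ))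

theorem realFourier_eq (f : ℝ → ℝ) (ξ : ℝ) :
    realFourier f ξ = ∫ x : ℝ, (f x : ℂ) * Complex.exp (2 * Real.pi * Complex.I * (-ξ * x)) := by
  rw [realFourier, Real.fourier_real_eq_integral_exp_smul]
  refine MeasureTheory.integral_congr_ae (Filter.Eventually.of_forall fun x => ?_)
  simp only [smul_eq_mul]
  rw [mul_comm]
  congr 2
  push_cast
  ring

/-- The class `𝒢_{k,ℓ}` of weights `ω = (ω_1, …, ω_k)`: each component is a non-negative `C^ℓ`
function supported in `[-2, 2]`, whose Fourier transform is real and non-negative everywhere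
and positive at the origin. -/
structure IsWeight {k : ℕ} (ℓ : ℕ) (ω : Fin k → ℝ → ℝ) : Prop where
  nonneg : ∀ i x, 0 ≤ ω i x
  supp : ∀ i, tsupport (ω i) ⊆ Set.Icc (-2) 2
  smooth : ∀ i, ContDiff ℝ ℓ (ω i)
  fourier_real : ∀ i ξ, (realFourier (ω i) ξ).im = 0
  fourier_nonneg : ∀ i ξ, 0 ≤ (realFourier (ω i) ξ).re
  fourier_zero_pos : ∀ i, 0 < (realFourier (ω i) 0).re

/-- `ℭ(ω)`, the product of the values `ω̂_i(0)`. -/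
noncomputable def weightConst {k : ℕ} (ω : Fin k → ℝ → ℝ) : ℝ :=
  ∏ i, (realFourier (ω i) 0).re

/-- The weight of the lattice point `a ∈ ℤ^(d+1)` in the smooth point count of the Kronecker
sequence of `α` in the box `(γ; ρ)`. The last coordinate of `a` is the
index in the sequence. -/
noncomputable def pointWeight {d : ℕ} (ω : Fin (d + 1) → ℝ → ℝ) (α γ ρ : Fin d → ℝ) (N : ℝ)
    (a : Fin (d + 1) → ℤ) : ℝ :=
  ω (Fin.last d) ((a (Fin.last d) : ℝ) / N) *
    ∏ i : Fin d, ω i.castSucc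
      (((a i.castSucc : ℝ) + (a (Fin.last d) : ℝ) * α i - γ i) / ρ i)

/-- The smooth point count is a finite sum. -/
theorem pointWeight_finite_support {d ℓ : ℕ} {ω : Fin (d + 1) → ℝ → ℝ} (hω : IsWeight ℓ ω)
    (α γ ρ : Fin d → ℝ) (hρ : ∀ i, 0 < ρ i) {N : ℝ} (hN : 0 < N) :
    (Function.support (pointWeight ω α γ ρ N)).Finite := by
  have key : ∀ (i : Fin (d + 1)) (x : ℝ), ω i x ≠ 0 → |x| ≤ 2 := fun i x hx =>
    abs_le.2 (hω.supp i (subset_tsupport _ hx))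
  set M : ℝ := 2 * N + ∑ i, (2 * ρ i + 2 * N * |α i| + |γ i|) with hM
  have hterm : ∀ i, 0 ≤ 2 * ρ i + 2 * N * |α i| + |γ i| := fun i => by
    have := hρ i
    positivity
  refine (Set.finite_Icc (fun _ : Fin (d + 1) => -⌈M⌉) (fun _ => ⌈M⌉)).subset fun a ha => ?_
  have ha' : pointWeight ω α γ ρ N a ≠ 0 := ha
  have h1 := left_ne_zero_of_mul ha'
  have h2 := right_ne_zero_of_mul ha'
  have hlast : |(a (Fin.last d) : ℝ)| ≤ 2 * N := by
    have := key _ _ h1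
    rwa [abs_div, abs_of_pos hN, div_le_iff₀ hN] at this
  have hall : ∀ j, |(a j : ℝ)| ≤ M := by
    intro j
    refine Fin.lastCases ?_ (fun i => ?_) j
    · have := Finset.sum_nonneg fun i (_ : i ∈ Finset.univ) => hterm i
      linarith
    · have h3 := key _ _ (Finset.prod_ne_zero_iff.1 h2 i (Finset.mem_univ i))
      rw [abs_div, abs_of_pos (hρ i), div_le_iff₀ (hρ i)] at h3
      have h4 : |(a (Fin.last d) : ℝ) * α i| ≤ 2 * N * |α i| := by
        rw [abs_mul]
        exact mul_le_mul_of_nonneg_right hlast (abs_nonneg _)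
      have h5 := Finset.single_le_sum (f := fun i => 2 * ρ i + 2 * N * |α i| + |γ i|)
        (fun i _ => hterm i) (Finset.mem_univ i)
      have h6 : |(a i.castSucc : ℝ)| ≤ 2 * ρ i + 2 * N * |α i| + |γ i| := by
        have e : (a i.castSucc : ℝ) = ((a i.castSucc : ℝ) + (a (Fin.last d) : ℝ) * α i - γ i)
            - (a (Fin.last d) : ℝ) * α i + γ i := by ring
        rw [e]
        refine (abs_add_le _ _).trans (add_le_add ((abs_sub _ _).trans ?_) le_rfl)
        exact add_le_add h3 h4
      have : M = 2 * N + ∑ i, (2 * ρ i + 2 * N * |α i| + |γ i|) := hM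
      linarith
  have hint : ∀ j, |a j| ≤ ⌈M⌉ := by
    intro j
    have h := (hall j).trans (Int.le_ceil M)
    exact_mod_cast h
  exact ⟨fun j => (abs_le.1 (hint j)).1, fun j => (abs_le.1 (hint j)).2⟩

/-- The smooth discrepancy `D_ω(𝔅; N)` of the Kronecker sequence of `α` in the box
`𝔅 = (γ; ρ)`: the smooth point count minus `ℭ(ω) vol(𝔅; N)`, where
`vol(𝔅; N) = ρ_1 ⋯ ρ_d N`. -/
noncomputable def boxDiscrepancy {d : ℕ} (ω : Fin (d + 1) → ℝ → ℝ) (α γ ρ : Fin d → ℝ)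
    (N : ℝ) : ℝ :=
  (∑' a : Fin (d + 1) → ℤ, pointWeight ω α γ ρ N a) - weightConst ω * ((∏ i, ρ i) * N)

/-- The smooth discrepancy `D_ω(α; N)`: the supremum, in `[0, ∞]`, of `|D_ω(𝔅; N)|` over all boxes
`𝔅 = (γ; ρ)` with `γ ∈ ℝ^d` and `ρ ∈ (0, 1/2)^d`. -/
noncomputable def smoothDiscrepancy {d : ℕ} (ω : Fin (d + 1) → ℝ → ℝ) (α : Fin d → ℝ)
    (N : ℝ) : ENNReal :=
  ⨆ (γ : Fin d → ℝ) (ρ : Fin d → ℝ) (_ : ∀ i, ρ i ∈ Set.Ioo (0 : ℝ) (1 / 2)),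
    ENNReal.ofReal |boxDiscrepancy ω α γ ρ N|

/-- `α` is `φ`-badly approximable in the dual multiplicative sense. -/
def DualBadlyApproximable {d : ℕ} (φ : ℝ → ℝ) (α : Fin d → ℝ) : Prop :=
  ∀ m : Fin d → ℤ, m ≠ 0 →
    1 / (mulHeight (fun i => (m i : ℝ)) * φ (mulHeight (fun i => (m i : ℝ)))) <
      distInt (∑ i, (m i : ℝ) * α i)

/-- `α` is a badly approximable number: `n ‖n α‖` is bounded away from zero. -/
def BadlyApproximable (α : ℝ) : Prop :=
  ∃ c : ℝ, 0 < c ∧ ∀ n : ℕ, 1 ≤ n → c ≤ (n : ℝ) * distInt ((n : ℝ) * α)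

/-- `L(x)`, the value of `H ≥ 1` such that `H φ(H) = x`. When `φ` jumps there need not be such
an `H`, and then `L(x)` is the point at which `H φ(H)` jumps past `x`. -/
noncomputable def invHeight (φ : ℝ → ℝ) (x : ℝ) : ℝ :=
  sSup {H : ℝ | 1 ≤ H ∧ H * φ H ≤ x}

theorem invHeight_eq {φ : ℝ → ℝ} (hmono : MonotoneOn φ (Set.Ici 1)) (hone : ∀ x, 1 ≤ x → 1 ≤ φ x)
    {H x : ℝ} (hH : 1 ≤ H) (hx : H * φ H = x) : invHeight φ x = H := by
  refine IsGreatest.csSup_eq ⟨⟨hH, hx.le⟩, ?_⟩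
  rintro K ⟨hK, hKx⟩
  by_contra! hlt
  have h1 : φ H ≤ φ K := hmono hH hK hlt.le
  have h2 := hone H hH
  nlinarith

end SmoothDisc

/-! Poisson summation in the first d coordinates turns the smooth count into a sum over m ∈ ℤ^d of a
Fourier coefficient of the box times a smoothed exponential sum in n at frequency m·α
(`tsum_pointWeight_eq_tsum_boxCoeff`). The term m = 0 is the expected volume up to O(1). Poisson
summation in n bounds the other exponential sums by N (1 + N‖m·α‖)^(-2), while smoothness of the
weights bounds the coefficients by ∏ ρ_i (1 + ρ_i|m_i|)^(-ℓ).

The m are grouped into dyadic boxes |m_i| ≤ 2^(j_i)/ρ_i. A difference of two points of such a box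
lies in the doubled box, so the Diophantine condition makes the values m·α separated modulo 1. This
gap principle bounds the sum over the box by Qφ(Q)/N up to a constant, where Q is the volume scale
of the box. The growth condition on φ makes the sum over j geometric, and N cancels: the discrepancy
of a box is O(φ(1/∏ρ_i)), uniformly in N ≥ 1 (`exists_abs_boxDiscrepancy_le`).

That bound degrades for small boxes. A box of volume below 1/Λ is therefore enclosed in one of
volume exactly 1/Λ, and its count and its expected value are bounded separately. This gives O(φ(Λ) +
N/Λ) for every box and every Λ ≥ 1; the choice Λ = L(N) balances the two terms. -/

namespace SmoothDisc

/-! ### Fourier decay from smoothness -/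

/-- A continuous compactly supported function whose Fourier transform is at most
`A (1 + |ξ|) ^ (-ℓ)`. -/
structure HasFourierDecay (ℓ : ℕ) (A : ℝ) (f : ℝ → ℝ) : Prop where
  continuous : Continuous f
  hasCompactSupport : HasCompactSupport f
  norm_le : ∀ ξ, ‖realFourier f ξ‖ ≤ A / (1 + |ξ|) ^ ℓ

theorem HasFourierDecay.const_nonneg {ℓ : ℕ} {A : ℝ} {f : ℝ → ℝ} (hf : HasFourierDecay ℓ A f) :
    0 ≤ A := by
  have := (norm_nonneg _).trans (hf.norm_le 0)
  simpa using this

theorem HasFourierDecay.mono {ℓ : ℕ} {A A' : ℝ} {f : ℝ → ℝ} (hf : HasFourierDecay ℓ A f)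
    (h : A ≤ A') : HasFourierDecay ℓ A' f :=
  ⟨hf.continuous, hf.hasCompactSupport, fun ξ => (hf.norm_le ξ).trans (by gcongr)⟩

theorem HasFourierDecay.norm_le_sq {ℓ : ℕ} {A : ℝ} {f : ℝ → ℝ} (hf : HasFourierDecay ℓ A f)
    (hℓ : 2 ≤ ℓ) (ξ : ℝ) : ‖realFourier f ξ‖ ≤ A / (1 + |ξ|) ^ 2 := by
  refine (hf.norm_le ξ).trans ?_
  have := hf.const_nonneg
  have h1 : 1 ≤ 1 + |ξ| := by linarith [abs_nonneg ξ]
  gcongr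

theorem norm_fourier_le_integral_norm (f : ℝ → ℂ) (ξ : ℝ) : ‖𝓕 f ξ‖ ≤ ∫ x, ‖f x‖ :=
  VectorFourier.norm_fourierIntegral_le_integral_norm _ _ _ f ξ

/-- Integration by parts ℓ times controls |ξ|^ℓ |f̂(ξ)|, and the L¹ norm of f controls low
frequencies. The two combine through (1 + |ξ|)^ℓ ≤ 2^(ℓ-1) (1 + |ξ|^ℓ). -/
theorem exists_hasFourierDecay {ℓ : ℕ} {f : ℝ → ℝ} (hf : ContDiff ℝ ℓ f)
    (hc : HasCompactSupport f) : ∃ A, HasFourierDecay ℓ A f := by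
  set g : ℝ → ℂ := fun x => (f x : ℂ) with hg
  have hgd : ContDiff ℝ ℓ g := Complex.ofRealCLM.contDiff.comp hf
  have hgc : HasCompactSupport g := hc.comp_left (g := fun x : ℝ => (x : ℂ)) (by simp)
  have hcs : ∀ n : ℕ, HasCompactSupport (iteratedDeriv n g) := by
    intro n
    have := (hgc.iteratedFDeriv (𝕜 := ℝ) n)
    exact this.comp_left (g := fun L : ContinuousMultilinearMap ℝ (fun _ : Fin n => ℝ) ℂ =>
      L fun _ => 1) (by simp)
  have hint : ∀ n : ℕ, (n : ℕ∞) ≤ (ℓ : ℕ∞) → MeasureTheory.Integrable (iteratedDeriv n g) := by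
    intro n hn
    refine Continuous.integrable_of_hasCompactSupport ?_ (hcs n)
    exact hgd.continuous_iteratedDeriv n (by exact_mod_cast hn)
  have hF := Real.fourier_iteratedDeriv (N := ℓ) (n := ℓ) (by exact_mod_cast hgd) hint le_rfl
  set A0 : ℝ := ∫ x, ‖g x‖
  set A1 : ℝ := ∫ x, ‖iteratedDeriv ℓ g x‖
  have h0 : 0 ≤ A0 := MeasureTheory.integral_nonneg fun _ => norm_nonneg _
  have h1 : 0 ≤ A1 := MeasureTheory.integral_nonneg fun _ => norm_nonneg _
  refine ⟨2 ^ (ℓ - 1) * (A0 + A1), hf.continuous, hc, fun ξ => ?_⟩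
  rw [le_div_iff₀ (by positivity)]
  have e0 : ‖realFourier f ξ‖ ≤ A0 := norm_fourier_le_integral_norm g ξ
  have e1 : |ξ| ^ ℓ * ‖realFourier f ξ‖ ≤ A1 := by
    have h := norm_fourier_le_integral_norm (iteratedDeriv ℓ g) ξ
    rw [hF] at h
    simp only [norm_smul, norm_pow, norm_mul, Complex.norm_I, Complex.norm_real, Real.norm_eq_abs,
      mul_one, Complex.norm_ofNat, abs_of_pos Real.pi_pos] at h
    refine le_trans ?_ h
    refine mul_le_mul_of_nonneg_right ?_ (norm_nonneg _)
    refine pow_le_pow_left₀ (abs_nonneg _) ?_ _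
    nlinarith [Real.pi_gt_three, abs_nonneg ξ]
  have e2 := add_pow_le (zero_le_one (α := ℝ)) (abs_nonneg ξ) ℓ
  rw [one_pow] at e2
  calc ‖realFourier f ξ‖ * (1 + |ξ|) ^ ℓ
      ≤ ‖realFourier f ξ‖ * (2 ^ (ℓ - 1) * (1 + |ξ| ^ ℓ)) := by gcongr
    _ = 2 ^ (ℓ - 1) * (‖realFourier f ξ‖ + |ξ| ^ ℓ * ‖realFourier f ξ‖) := by ring
    _ ≤ _ := by gcongr

/-! ### Characters and Poisson summation in one variable -/

/-- The character `x ↦ e(x) = exp(2 π i x)`. -/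
noncomputable def expChar (x : ℝ) : ℂ := Complex.exp (2 * Real.pi * Complex.I * x)

theorem expChar_add (x y : ℝ) : expChar (x + y) = expChar x * expChar y := by
  simp only [expChar, ← Complex.exp_add]; congr 1; push_cast; ring

theorem expChar_zero : expChar 0 = 1 := by simp [expChar]

theorem norm_expChar (x : ℝ) : ‖expChar x‖ = 1 := by
  have : expChar x = Complex.exp ((2 * Real.pi * x : ℝ) * Complex.I) := by
    rw [expChar]; congr 1; push_cast; ring
  rw [this, Complex.norm_exp_ofReal_mul_I]

theorem expChar_int (n : ℤ) : expChar n = 1 := by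
  rw [expChar, Complex.exp_eq_one_iff]
  exact ⟨n, by push_cast; ring⟩

theorem continuous_expChar : Continuous expChar := by unfold expChar; fun_prop

theorem expChar_sum {ι : Type*} (s : Finset ι) (f : ι → ℝ) :
    expChar (∑ i ∈ s, f i) = ∏ i ∈ s, expChar (f i) := by
  classical
  induction s using Finset.induction_on with
  | empty => simp [expChar_zero]
  | insert a s ha ih => rw [Finset.sum_insert ha, Finset.prod_insert ha, expChar_add, ih]

theorem fourier_expChar_mul_comp_div (f : ℝ → ℝ) {s : ℝ} (hs : 0 < s) (θ w : ℝ) :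
    𝓕 (fun x : ℝ => expChar (x * θ) * (f (x / s) : ℂ)) w = s * realFourier f (s * (w - θ)) := by
  rw [realFourier, Real.fourier_real_eq_integral_exp_smul, Real.fourier_real_eq_integral_exp_smul]
  have := MeasureTheory.Measure.integral_comp_div
    (fun v : ℝ => Complex.exp (↑(-2 * Real.pi * v * (s * (w - θ))) * Complex.I) • (f v : ℂ)) s
  rw [abs_of_pos hs, Complex.real_smul] at this
  rw [← this]
  refine MeasureTheory.integral_congr_ae (Filter.Eventually.of_forall fun v => ?_)
  simp only [smul_eq_mul, expChar, ← mul_assoc, ← Complex.exp_add]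
  congr 2
  have : (s : ℂ) ≠ 0 := by exact_mod_cast hs.ne'
  push_cast
  field_simp
  ring

theorem summable_one_div_one_add_mul_abs_sq {s : ℝ} (hs : 0 < s) :
    Summable fun m : ℤ => 1 / (1 + s * |(m : ℝ)|) ^ 2 := by
  have h := ((Real.summable_one_div_int_pow (p := 2)).2 one_lt_two).mul_left (1 / s ^ 2)
  refine h.of_norm_bounded_eventually ?_
  filter_upwards [(Set.finite_singleton (0 : ℤ)).compl_mem_cofinite] with m hm
  have hm' : (0 : ℝ) < |(m : ℝ)| := abs_pos.2 (by exact_mod_cast hm)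
  rw [Real.norm_of_nonneg (by positivity), ← sq_abs (m : ℝ), one_div_mul_one_div, ← mul_pow]
  gcongr
  linarith

theorem HasFourierDecay.summable_norm {ℓ : ℕ} {A : ℝ} {f : ℝ → ℝ} (hf : HasFourierDecay ℓ A f)
    (hℓ : 2 ≤ ℓ) {s : ℝ} (hs : 0 < s) (θ : ℝ) :
    Summable fun m : ℤ => ‖realFourier f (s * (m - θ))‖ := by
  refine Summable.of_nonneg_of_le (fun _ => norm_nonneg _) (fun m => ?_)
    ((summable_one_div_one_add_mul_abs_sq hs).mul_left (A * (1 + s * |θ|) ^ 2))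
  refine (hf.norm_le_sq hℓ _).trans ?_
  have hA := hf.const_nonneg
  rw [abs_mul, abs_of_pos hs, mul_one_div, div_le_div_iff₀ (by positivity) (by positivity),
    mul_assoc, ← mul_pow]
  gcongr
  have h1 : |(m : ℝ)| ≤ |(m : ℝ) - θ| + |θ| := by
    simpa using abs_add_le ((m : ℝ) - θ) θ
  have : s * |(m : ℝ)| ≤ s * (|(m : ℝ) - θ| + |θ|) := by gcongr
  have h3 : 0 ≤ (s * |θ|) * (s * |(m : ℝ) - θ|) := by positivity
  linarith

/-- Poisson summation for a dilated and modulated function. -/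
theorem HasFourierDecay.poisson {ℓ : ℕ} {A : ℝ} {f : ℝ → ℝ} (hf : HasFourierDecay ℓ A f)
    (hℓ : 2 ≤ ℓ) {s : ℝ} (hs : 0 < s) (θ y : ℝ) :
    ∑' n : ℤ, expChar ((n + y) * θ) * (f ((n + y) / s) : ℂ) =
      ∑' m : ℤ, s * realFourier f (s * (m - θ)) * expChar (m * y) := by
  set g : ℝ → ℂ := fun x : ℝ => expChar (x * θ) * (f (x / s) : ℂ) with hg
  have hgc : Continuous g :=
    (continuous_expChar.comp (continuous_id.mul continuous_const)).mul
      (Complex.continuous_ofReal.comp (hf.continuous.comp (continuous_id.div_const s)))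
  have hfs : HasCompactSupport fun x : ℝ => f (x / s) := by
    have := hf.hasCompactSupport.comp_homeomorph (Homeomorph.mulRight₀ s⁻¹ (inv_ne_zero hs.ne'))
    simpa [Function.comp_def, div_eq_mul_inv] using this
  have hgs : HasCompactSupport g :=
    (hfs.comp_left (g := fun x : ℝ => (x : ℂ)) (by simp)).mul_left
  have hO : g =O[Filter.cocompact ℝ] fun x : ℝ => |x| ^ (-(2 : ℝ)) := by
    have h0 := hasCompactSupport_iff_eventuallyEq.1 hgs
    rw [Filter.coclosedCompact_eq_cocompact] at h0
    exact h0.trans_isBigO (Asymptotics.isBigO_zero _ _)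
  have hF : ∀ m : ℤ, 𝓕 g m = s * realFourier f (s * (m - θ)) := fun m =>
    fourier_expChar_mul_comp_div f hs θ m
  have hsum : Summable fun m : ℤ => 𝓕 g m := by
    refine Summable.of_norm ?_
    simp only [hF, norm_mul]
    exact (hf.summable_norm hℓ hs θ).mul_left _
  have key := Real.tsum_eq_tsum_fourier_of_rpow_decay_of_summable hgc one_lt_two hO hsum y
  have e1 : ∀ n : ℤ, expChar ((n + y) * θ) * (f ((n + y) / s) : ℂ) = g (y + n) := fun n => by
    simp only [hg, add_comm]
  simp only [e1, key]
  refine tsum_congr fun m => ?_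
  rw [hF, fourier_coe_apply, expChar]
  congr 2
  push_cast
  ring

/-! ### Smoothed exponential sums -/

theorem summable_one_div_one_add_abs_sq : Summable fun m : ℤ => 1 / (1 + |(m : ℝ)|) ^ 2 := by
  simpa using summable_one_div_one_add_mul_abs_sq one_pos

theorem one_le_abs_intCast {m : ℤ} (hm : m ≠ 0) : (1 : ℝ) ≤ |(m : ℝ)| := by
  exact_mod_cast Int.one_le_abs hm

/-- For m ≠ 0 one has |m - τ| ≥ |m|/2, so the nearest frequency m = 0 is the worst. The product form
decouples m from τ: squared, it leaves a convergent sum over m. -/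
theorem one_add_abs_mul_le {N τ : ℝ} (hN : 1 ≤ N) (hτ : |τ| ≤ 1 / 2) (m : ℤ) :
    (1 + |(m : ℝ)|) * (1 + N * |τ|) ≤ 8 * (1 + N * |(m : ℝ) - τ|) := by
  rcases eq_or_ne m 0 with rfl | hm
  · have : 0 ≤ N * |τ| := by positivity
    simp only [Int.cast_zero, abs_zero, zero_sub, abs_neg]
    linarith
  · have h1 := one_le_abs_intCast hm
    have h2 : |(m : ℝ)| ≤ |(m : ℝ) - τ| + |τ| := by simpa using abs_add_le ((m : ℝ) - τ) τ
    have h3 : N * |(m : ℝ)| ≤ N * (2 * |(m : ℝ) - τ|) := by gcongr; linarith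
    have h4 : N * |τ| ≤ N * (1 / 2) := by gcongr
    have h5 : (1 + |(m : ℝ)|) * (1 + N * |τ|) ≤ (2 * |(m : ℝ)|) * (2 * N) := by
      gcongr <;> linarith
    linarith

/-- Since n is an integer, θ may be replaced by its signed residue τ with |τ| = ‖θ‖. After Poisson
summation the decay of f̂ applies at N(m - τ); the constant 64 is 8² from `one_add_abs_mul_le`. -/
theorem HasFourierDecay.norm_expSum_le {ℓ : ℕ} {A : ℝ} {f : ℝ → ℝ} (hf : HasFourierDecay ℓ A f)
    (hℓ : 2 ≤ ℓ) {N : ℝ} (hN : 1 ≤ N) (θ : ℝ) :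
    ‖∑' n : ℤ, expChar (n * θ) * (f (n / N) : ℂ)‖ ≤
      64 * A * (∑' m : ℤ, 1 / (1 + |(m : ℝ)|) ^ 2) * (N / (1 + N * distInt θ) ^ 2) := by
  have hA := hf.const_nonneg
  have hN0 : 0 < N := by linarith
  set τ : ℝ := θ - round θ with hτ
  have hτ2 : |τ| ≤ 1 / 2 := abs_sub_round θ
  have e1 : ∀ n : ℤ, expChar (n * θ) * (f (n / N) : ℂ) =
      expChar ((n + (0 : ℝ)) * τ) * (f ((n + (0 : ℝ)) / N) : ℂ) := by
    intro n
    have : (n : ℝ) * θ = n * τ + ((n * round θ : ℤ) : ℝ) := by push_cast; rw [hτ]; ring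
    rw [this, expChar_add, expChar_int, add_zero, mul_one]
  rw [tsum_congr e1, hf.poisson hℓ hN0]
  have hb : ∀ m : ℤ, ‖(N : ℂ) * realFourier f (N * (m - τ)) * expChar (m * 0)‖ ≤
      64 * A * (N / (1 + N * distInt θ) ^ 2) * (1 / (1 + |(m : ℝ)|) ^ 2) := by
    intro m
    rw [norm_mul, norm_expChar, mul_one, norm_mul, Complex.norm_real, Real.norm_of_nonneg hN0.le]
    have h1 := hf.norm_le_sq hℓ (N * (m - τ))
    rw [abs_mul, abs_of_pos hN0] at h1
    refine (mul_le_mul_of_nonneg_left h1 hN0.le).trans ?_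
    have h2 := one_add_abs_mul_le hN hτ2 m
    have h3 := pow_le_pow_left₀ (by positivity) h2 2
    have : distInt θ = |τ| := rfl
    rw [this]
    have hNA : 0 ≤ N * A := by positivity
    have e : 64 * A * (N / (1 + N * |τ|) ^ 2) * (1 / (1 + |(m : ℝ)|) ^ 2) =
        (64 * (N * A)) / ((1 + |(m : ℝ)|) * (1 + N * |τ|)) ^ 2 := by
      rw [mul_pow]; field_simp
    rw [e, ← mul_div_assoc, div_le_div_iff₀ (by positivity) (by positivity)]
    have := mul_le_mul_of_nonneg_left h3 hNA
    linarith
  refine (tsum_of_norm_bounded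
    ((summable_one_div_one_add_abs_sq.mul_left _).hasSum) hb).trans (le_of_eq ?_)
  rw [tsum_mul_left]
  ring

/-- The zero frequency in Poisson summation is the integral. The others total O(1) because N (1 +
N|m|)^(-2) is at most 4 (1 + |m|)^(-2) for m ≠ 0 and N ≥ 1. -/
theorem HasFourierDecay.norm_sum_sub_le {ℓ : ℕ} {A : ℝ} {f : ℝ → ℝ} (hf : HasFourierDecay ℓ A f)
    (hℓ : 2 ≤ ℓ) {N : ℝ} (hN : 1 ≤ N) :
    ‖∑' n : ℤ, (f (n / N) : ℂ) - N * realFourier f 0‖ ≤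
      4 * A * ∑' m : ℤ, 1 / (1 + |(m : ℝ)|) ^ 2 := by
  have hA := hf.const_nonneg
  have hN0 : 0 < N := by linarith
  have e1 : ∀ n : ℤ, (f (n / N) : ℂ) =
      expChar ((n + (0 : ℝ)) * 0) * (f ((n + (0 : ℝ)) / N) : ℂ) := by
    intro n
    rw [mul_zero, expChar_zero, add_zero, one_mul]
  rw [tsum_congr e1, hf.poisson hℓ hN0]
  simp only [mul_zero, sub_zero, expChar_zero, mul_one]
  have hs : Summable fun m : ℤ => (N : ℂ) * realFourier f (N * m) := by
    refine Summable.mul_left _ (Summable.of_norm ?_)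
    simpa using hf.summable_norm hℓ hN0 0
  rw [hs.tsum_eq_add_tsum_ite 0]
  simp only [Int.cast_zero, mul_zero, add_sub_cancel_left]
  rw [← tsum_mul_left]
  refine tsum_of_norm_bounded ((summable_one_div_one_add_abs_sq.mul_left _).hasSum) fun m => ?_
  split_ifs with hm
  · rw [norm_zero]; positivity
  rw [norm_mul, Complex.norm_real, Real.norm_of_nonneg hN0.le]
  have h1 := hf.norm_le_sq hℓ (N * m)
  rw [abs_mul, abs_of_pos hN0] at h1
  refine (mul_le_mul_of_nonneg_left h1 hN0.le).trans ?_
  have h2 := one_le_abs_intCast hm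
  have h3 : N * (1 + |(m : ℝ)|) ^ 2 ≤ 4 * (1 + N * |(m : ℝ)|) ^ 2 := by
    have h4 : N * (1 + |(m : ℝ)|) ^ 2 ≤ N * (2 * |(m : ℝ)|) ^ 2 := by gcongr; linarith
    have h5 : N * |(m : ℝ)| ^ 2 ≤ (N * |(m : ℝ)|) ^ 2 := by rw [mul_pow]; gcongr; nlinarith
    have h6 : (N * |(m : ℝ)|) ^ 2 ≤ (1 + N * |(m : ℝ)|) ^ 2 := by gcongr; linarith
    linarith
  rw [mul_one_div, ← mul_div_assoc, div_le_div_iff₀ (by positivity) (by positivity)]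
  have := mul_le_mul_of_nonneg_left h3 hA
  linarith

/-! ### Poisson summation for the box count -/

theorem summable_norm_prod_and_prod_tsum {κ : Type*} : ∀ {d : ℕ} {f : Fin d → κ → ℂ},
    (∀ i, Summable fun j => ‖f i j‖) →
      (Summable fun m : Fin d → κ => ‖∏ i, f i (m i)‖) ∧
        ∏ i, ∑' j, f i j = ∑' m : Fin d → κ, ∏ i, f i (m i)
  | 0, f, _ => by
    refine ⟨(hasSum_fintype _).summable, ?_⟩
    rw [tsum_fintype]
    simp
  | d + 1, f, hf => by
    obtain ⟨h1, h2⟩ := summable_norm_prod_and_prod_tsum (f := fun i : Fin d => f i.succ)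
      fun i => hf i.succ
    let e : κ × (Fin d → κ) ≃ (Fin (d + 1) → κ) := Fin.consEquiv fun _ => κ
    have he : ∀ p, ∏ i, f i (e p i) = f 0 p.1 * ∏ i : Fin d, f i.succ (p.2 i) := by
      intro p
      rw [Fin.prod_univ_succ]
      simp [e, Fin.consEquiv]
    constructor
    · rw [← e.summable_iff]
      have := (hf 0).mul_norm h1
      exact this.congr fun p => by simp only [Function.comp_apply, he]
    · rw [← e.tsum_eq, Fin.prod_univ_succ, h2, tsum_mul_tsum_of_summable_norm (hf 0) h1]
      exact tsum_congr fun p => (he p).symm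

theorem ofReal_re_realFourier_zero (f : ℝ → ℝ) :
    ((realFourier f 0).re : ℂ) = realFourier f 0 := by
  have : realFourier f 0 = ((∫ x, f x : ℝ) : ℂ) := by
    rw [realFourier_eq, ← integral_complex_ofReal]
    simp
  rw [this, Complex.ofReal_re]

theorem finite_support_comp_intCast_add_div {f : ℝ → ℝ} (hf : HasCompactSupport f) {s : ℝ}
    (hs : 0 < s) (y : ℝ) : (Function.support fun n : ℤ => f ((n + y) / s)).Finite := by
  obtain ⟨R, hR⟩ := hf.isBounded.subset_closedBall 0
  refine (Set.finite_Icc (-⌈s * R + |y|⌉) ⌈s * R + |y|⌉).subset fun n hn => ?_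
  have h1 : |((n : ℝ) + y) / s| ≤ R := by
    simpa only [mem_closedBall_zero_iff, Real.norm_eq_abs] using hR (subset_tsupport f hn)
  rw [abs_div, abs_of_pos hs, div_le_iff₀ hs] at h1
  have h2 : |(n : ℝ)| ≤ s * R + |y| := by
    have : |(n : ℝ)| ≤ |(n : ℝ) + y| + |y| := by simpa using abs_sub (n + y : ℝ) y
    linarith
  have h3 : |n| ≤ ⌈s * R + |y|⌉ := by exact_mod_cast h2.trans (Int.le_ceil _)
  exact abs_le.1 h3

variable {d : ℕ}

theorem finite_support_pointWeight {ω : Fin (d + 1) → ℝ → ℝ}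
    (hω : ∀ i, HasCompactSupport (ω i)) (α γ ρ : Fin d → ℝ) (hρ : ∀ i, 0 < ρ i) {N : ℝ}
    (hN : 0 < N) : (Function.support (pointWeight ω α γ ρ N)).Finite := by
  have h0 := finite_support_comp_intCast_add_div (hω (Fin.last d)) hN 0
  have h1 := fun (n : ℤ) => Set.Finite.pi fun i : Fin d =>
    finite_support_comp_intCast_add_div (hω i.castSucc) (hρ i) (n * α i - γ i)
  refine (h0.biUnion fun n _ => (h1 n).image fun m => (Fin.snoc m n : Fin (d + 1) → ℤ)).subset
    fun a ha => ?_
  have ha' : pointWeight ω α γ ρ N a ≠ 0 := ha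
  refine Set.mem_biUnion (x := a (Fin.last d)) ?_ ⟨Fin.init a, ?_, Fin.snoc_init_self a⟩
  · simpa using left_ne_zero_of_mul ha'
  · intro i _
    have := Finset.prod_ne_zero_iff.1 (right_ne_zero_of_mul ha') i (Finset.mem_univ i)
    simpa [Fin.init, add_sub_assoc] using this

theorem tsum_pointWeight_eq {ω : Fin (d + 1) → ℝ → ℝ}
    (hω : ∀ i, HasCompactSupport (ω i)) (α γ ρ : Fin d → ℝ) (hρ : ∀ i, 0 < ρ i) {N : ℝ}
    (hN : 0 < N) : ((∑' a, pointWeight ω α γ ρ N a : ℝ) : ℂ) =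
      ∑' n : ℤ, (ω (Fin.last d) (n / N) : ℂ) *
        ∏ i : Fin d, ∑' m : ℤ, (ω i.castSucc ((m + (n * α i - γ i)) / ρ i) : ℂ) := by
  let e : ℤ × (Fin d → ℤ) ≃ (Fin (d + 1) → ℤ) := Fin.snocEquiv fun _ => ℤ
  have hs : Summable fun a => (pointWeight ω α γ ρ N a : ℂ) := by
    refine summable_of_hasFiniteSupport ((finite_support_pointWeight hω α γ ρ hρ hN).subset ?_)
    intro a ha h
    exact ha (by simp [h])
  have hv : ∀ (n : ℤ) (i : Fin d),
      Summable fun m : ℤ => ‖(ω i.castSucc ((m + (n * α i - γ i)) / ρ i) : ℂ)‖ := by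
    intro n i
    refine summable_of_hasFiniteSupport
      ((finite_support_comp_intCast_add_div (hω i.castSucc) (hρ i) (n * α i - γ i)).subset ?_)
    intro a ha h
    exact ha (by simp [h])
  rw [Complex.ofReal_tsum, ← e.tsum_eq,
    Summable.tsum_prod (f := fun c => (pointWeight ω α γ ρ N (e c) : ℂ)) (e.summable_iff.2 hs)]
  refine tsum_congr fun n => ?_
  rw [(summable_norm_prod_and_prod_tsum (hv n)).2, ← tsum_mul_left]
  refine tsum_congr fun m => ?_
  simp [pointWeight, e, Fin.snocEquiv, add_sub_assoc]

/-- The Fourier coefficients of the periodized box weight. -/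
noncomputable def boxCoeff (ω : Fin (d + 1) → ℝ → ℝ) (γ ρ : Fin d → ℝ) (m : Fin d → ℤ) : ℂ :=
  ∏ i, ρ i * realFourier (ω i.castSucc) (ρ i * m i) * expChar (-(m i * γ i))

theorem summable_norm_boxCoeff {ω : Fin (d + 1) → ℝ → ℝ} {ℓ : ℕ} {A : ℝ}
    (hω : ∀ i, HasFourierDecay ℓ A (ω i)) (hℓ : 2 ≤ ℓ) (γ ρ : Fin d → ℝ) (hρ : ∀ i, 0 < ρ i) :
    Summable fun m => ‖boxCoeff ω γ ρ m‖ := by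
  refine (summable_norm_prod_and_prod_tsum (f := fun (i : Fin d) (m : ℤ) =>
    ρ i * realFourier (ω i.castSucc) (ρ i * m) * expChar (-(m * γ i))) fun i => ?_).1
  simp only [norm_mul, norm_expChar, mul_one]
  simpa using ((hω i.castSucc).summable_norm hℓ (hρ i) 0).mul_left ‖(ρ i : ℂ)‖

/-- For fixed n the count factors over coordinates, and each factor is transformed by Poisson
summation. The sums over n and m may be exchanged because the box coefficients are absolutely
summable and only finitely many n contribute. -/
theorem tsum_pointWeight_eq_tsum_boxCoeff {ω : Fin (d + 1) → ℝ → ℝ} {ℓ : ℕ} {A : ℝ}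
    (hω : ∀ i, HasFourierDecay ℓ A (ω i)) (hℓ : 2 ≤ ℓ) (α γ ρ : Fin d → ℝ) (hρ : ∀ i, 0 < ρ i)
    {N : ℝ} (hN : 0 < N) : ((∑' a, pointWeight ω α γ ρ N a : ℝ) : ℂ) =
      ∑' m : Fin d → ℤ, boxCoeff ω γ ρ m *
        ∑' n : ℤ, expChar (n * ∑ i, m i * α i) * (ω (Fin.last d) (n / N) : ℂ) := by
  rw [tsum_pointWeight_eq (fun i => (hω i).hasCompactSupport) α γ ρ hρ hN]
  have hc := summable_norm_boxCoeff hω hℓ γ ρ hρ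
  have h1 : ∀ n : ℤ, ∏ i : Fin d, ∑' m : ℤ, (ω i.castSucc ((m + (n * α i - γ i)) / ρ i) : ℂ) =
      ∑' m : Fin d → ℤ, boxCoeff ω γ ρ m * expChar (n * ∑ i, m i * α i) := by
    intro n
    have h2 : ∀ i : Fin d, ∑' m : ℤ, (ω i.castSucc ((m + (n * α i - γ i)) / ρ i) : ℂ) =
        ∑' m : ℤ, ρ i * realFourier (ω i.castSucc) (ρ i * m) * expChar (m * (n * α i - γ i)) := by
      intro i
      have := (hω i.castSucc).poisson hℓ (hρ i) 0 (n * α i - γ i)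
      simpa [expChar_zero] using this
    rw [Finset.prod_congr rfl fun i _ => h2 i, (summable_norm_prod_and_prod_tsum fun i => ?_).2]
    · refine tsum_congr fun m => ?_
      rw [boxCoeff, Finset.mul_sum, expChar_sum, ← Finset.prod_mul_distrib]
      refine Finset.prod_congr rfl fun i _ => ?_
      rw [mul_assoc _ (expChar _), ← expChar_add]
      congr 2
      ring
    · simp only [norm_mul, norm_expChar, mul_one]
      simpa using ((hω i.castSucc).summable_norm hℓ (hρ i) 0).mul_left ‖(ρ i : ℂ)‖
  have hu : Summable fun n : ℤ => ‖(ω (Fin.last d) (n / N) : ℂ)‖ := by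
    refine summable_of_hasFiniteSupport ((finite_support_comp_intCast_add_div
      (hω (Fin.last d)).hasCompactSupport hN 0).subset ?_)
    intro a ha h
    exact ha (by simpa using h)
  simp only [h1, ← tsum_mul_left]
  rw [Summable.tsum_comm]
  · refine tsum_congr fun m => tsum_congr fun n => ?_
    ring
  · refine Summable.of_norm ((hc.mul_of_nonneg hu (fun _ => norm_nonneg _)
      fun _ => norm_nonneg _).congr fun p => ?_)
    simp only [Function.uncurry, norm_mul, norm_expChar, mul_one]
    ring

theorem norm_boxCoeff_le {ω : Fin (d + 1) → ℝ → ℝ} {ℓ : ℕ} {A : ℝ}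
    (hω : ∀ i, HasFourierDecay ℓ A (ω i)) (γ ρ : Fin d → ℝ) (hρ : ∀ i, 0 < ρ i)
    (m : Fin d → ℤ) : ‖boxCoeff ω γ ρ m‖ ≤ A ^ d * (∏ i, ρ i) *
      ∏ i, 1 / (1 + ρ i * |(m i : ℝ)|) ^ ℓ := by
  have : A ^ d = ∏ _i : Fin d, A := by simp
  rw [this, ← Finset.prod_mul_distrib, ← Finset.prod_mul_distrib, boxCoeff, norm_prod]
  refine Finset.prod_le_prod (fun _ _ => norm_nonneg _) fun i _ => ?_
  have h := (hω i.castSucc).norm_le (ρ i * m i)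
  rw [abs_mul, abs_of_pos (hρ i)] at h
  rw [norm_mul, norm_expChar, mul_one, norm_mul, Complex.norm_real, Real.norm_of_nonneg (hρ i).le]
  have := mul_le_mul_of_nonneg_left h (hρ i).le
  refine this.trans (le_of_eq ?_)
  ring

/-- The zero frequency cancels the volume term up to O(1); absolute values are taken in the rest.
Extended non-negative reals let the later regroupings of this sum proceed without summability
conditions. -/
theorem ofReal_abs_boxDiscrepancy_le {ω : Fin (d + 1) → ℝ → ℝ} {ℓ : ℕ} {A : ℝ}
    (hω : ∀ i, HasFourierDecay ℓ A (ω i)) (hℓ : 2 ≤ ℓ) : ∃ C : ℝ, 0 ≤ C ∧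
      ∀ (α γ ρ : Fin d → ℝ), (∀ i, 0 < ρ i) → (∀ i, ρ i ≤ 1) → ∀ N : ℝ, 1 ≤ N →
      ENNReal.ofReal |boxDiscrepancy ω α γ ρ N| ≤ ENNReal.ofReal C +
        ENNReal.ofReal (C * ((∏ i, ρ i) * N)) * ∑' m : {m : Fin d → ℤ // m ≠ 0},
          ENNReal.ofReal ((∏ i, 1 / (1 + ρ i * |(m.1 i : ℝ)|) ^ ℓ) *
            (1 / (1 + N * distInt (∑ i, (m.1 i : ℝ) * α i)) ^ 2)) := by
  have hA := (hω 0).const_nonneg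
  set S : ℝ := ∑' m : ℤ, 1 / (1 + |(m : ℝ)|) ^ 2 with hS
  have hS0 : 0 ≤ S := tsum_nonneg fun m => by positivity
  -- `A ^ d` comes from the d box coefficients and `64 * A * S` from the exponential sum; the latter
  -- also covers the error `4 * A * S` at frequency zero.
  refine ⟨A ^ d * (64 * A * S), by positivity, fun α γ ρ hρ hρ1 N hN => ?_⟩
  have hN0 : 0 < N := by linarith
  have hP : 0 < ∏ i, ρ i := Finset.prod_pos fun i _ => hρ i
  have hP1 : ∏ i, ρ i ≤ 1 := Finset.prod_le_one (fun i _ => (hρ i).le) fun i _ => hρ1 i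
  set T : (Fin d → ℤ) → ℂ := fun m =>
    ∑' n : ℤ, expChar (n * ∑ i, m i * α i) * (ω (Fin.last d) (n / N) : ℂ) with hT
  have hTle : ∀ m, ‖T m‖ ≤ 64 * A * S * (N / (1 + N * distInt (∑ i, (m i : ℝ) * α i)) ^ 2) :=
    fun m => (hω (Fin.last d)).norm_expSum_le hℓ hN _
  have hd : ∀ x, 0 ≤ distInt x := fun x => abs_nonneg _
  have hsum : Summable fun m => boxCoeff ω γ ρ m * T m := by
    refine Summable.of_norm_bounded
      ((summable_norm_boxCoeff hω hℓ γ ρ hρ).mul_right (64 * A * S * N)) fun m => ?_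
    rw [norm_mul]
    refine mul_le_mul_of_nonneg_left ((hTle m).trans ?_) (norm_nonneg _)
    refine mul_le_mul_of_nonneg_left (div_le_self hN0.le ?_) (by positivity)
    have : 0 ≤ N * distInt (∑ i, (m i : ℝ) * α i) := mul_nonneg hN0.le (hd _)
    nlinarith
  have hmain : ((weightConst ω * ((∏ i, ρ i) * N) : ℝ) : ℂ) =
      boxCoeff ω γ ρ 0 * (N * realFourier (ω (Fin.last d)) 0) := by
    rw [weightConst, Fin.prod_univ_castSucc]
    push_cast
    simp only [ofReal_re_realFourier_zero, boxCoeff]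
    simp only [Pi.zero_apply, Int.cast_zero, mul_zero, zero_mul, neg_zero, expChar_zero, mul_one,
      Finset.prod_mul_distrib]
    ring
  have hD : ((boxDiscrepancy ω α γ ρ N : ℝ) : ℂ) =
      boxCoeff ω γ ρ 0 * (T 0 - N * realFourier (ω (Fin.last d)) 0) +
        ∑' m : {m : Fin d → ℤ // m ≠ 0}, boxCoeff ω γ ρ m * T m := by
    rw [boxDiscrepancy, Complex.ofReal_sub, hmain,
      tsum_pointWeight_eq_tsum_boxCoeff hω hℓ α γ ρ hρ hN0]
    change ∑' m, boxCoeff ω γ ρ m * T m - _ = _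
    rw [← hsum.tsum_subtype_add_tsum_subtype_compl {0},
      tsum_singleton 0 fun m => boxCoeff ω γ ρ m * T m]
    have : ∑' m : (({0} : Set (Fin d → ℤ))ᶜ : Set _), boxCoeff ω γ ρ m * T m =
      ∑' m : {m : Fin d → ℤ // m ≠ 0}, boxCoeff ω γ ρ m * T m := rfl
    rw [this]
    ring
  have hT0 : ‖T 0 - N * realFourier (ω (Fin.last d)) 0‖ ≤ 4 * A * S := by
    have := (hω (Fin.last d)).norm_sum_sub_le hℓ hN
    simpa only [hT, Pi.zero_apply, Int.cast_zero, zero_mul, Finset.sum_const_zero, mul_zero,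
      expChar_zero, one_mul] using this
  rw [← Real.norm_eq_abs, ← Complex.norm_real, ofReal_norm, hD]
  refine (enorm_add_le _ _).trans (add_le_add ?_ (enorm_tsum_le_tsum_enorm.trans ?_))
  · rw [← ofReal_norm]
    refine ENNReal.ofReal_le_ofReal ?_
    rw [norm_mul]
    refine mul_le_mul ((norm_boxCoeff_le hω γ ρ hρ 0).trans ?_) (hT0.trans ?_) (norm_nonneg _)
      (by positivity)
    · simp only [Pi.zero_apply, Int.cast_zero, abs_zero, mul_zero, add_zero, one_pow, div_one,
        Finset.prod_const_one, mul_one]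
      exact mul_le_of_le_one_right (by positivity) hP1
    · nlinarith [mul_nonneg hA hS0]
  · rw [← ENNReal.tsum_mul_left]
    refine ENNReal.tsum_le_tsum fun m => ?_
    rw [← ofReal_norm, ← ENNReal.ofReal_mul (by positivity)]
    refine ENNReal.ofReal_le_ofReal ?_
    rw [norm_mul]
    refine (mul_le_mul (norm_boxCoeff_le hω γ ρ hρ m.1) (hTle m.1) (norm_nonneg _)
      ?_).trans (le_of_eq ?_)
    · refine mul_nonneg (by positivity) (Finset.prod_nonneg fun i _ => ?_)
      have := hρ i
      positivity
    · ring

/-! ### The gap principle -/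

theorem tsum_one_div_one_add_mul_succ_sq_le {x : ℝ} (hx : 0 < x) :
    ∑' n : ℕ, ENNReal.ofReal (1 / (1 + x * (n + 1)) ^ 2) ≤ ENNReal.ofReal (1 / x) := by
  refine ENNReal.tsum_le_of_sum_range_le fun n => ?_
  rw [← ENNReal.ofReal_sum_of_nonneg fun i _ => by positivity]
  refine ENNReal.ofReal_le_ofReal ?_
  -- Telescoping: one of the two factors 1 + x(i+1) is lowered to 1 + xi.
  have key : ∑ i ∈ Finset.range n, 1 / (1 + x * ((i : ℝ) + 1)) ^ 2 ≤
      1 / x - 1 / (x * (1 + x * n)) := by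
    induction n with
    | zero => simp
    | succ n ih =>
      rw [Finset.sum_range_succ]
      push_cast
      have h1 : 1 / (1 + x * ((n : ℝ) + 1)) ^ 2 ≤
          1 / (x * (1 + x * n)) - 1 / (x * (1 + x * (n + 1))) := by
        have : 1 / (x * (1 + x * n)) - 1 / (x * (1 + x * (n + 1))) =
            1 / ((1 + x * n) * (1 + x * (n + 1))) := by
          field_simp
          ring
        rw [this, sq]
        gcongr
        linarith
      linarith
  have : 0 ≤ 1 / (x * (1 + x * n)) := by positivity
  linarith

theorem tsum_int_one_div_one_add_mul_abs_sq_le {x : ℝ} (hx : 0 < x) :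
    ∑' j : ℤ, (if j = 0 then 0 else ENNReal.ofReal (1 / (1 + x * |(j : ℝ)|) ^ 2)) ≤
      ENNReal.ofReal (2 / x) := by
  have h := HasSum.of_nat_of_neg_add_one
    (f := fun j : ℤ => if j = 0 then 0 else ENNReal.ofReal (1 / (1 + x * |(j : ℝ)|) ^ 2))
    ENNReal.summable.hasSum ENNReal.summable.hasSum
  have h0 := tsum_one_div_one_add_mul_succ_sq_le hx
  rw [h.tsum_eq, tsum_eq_zero_add' ENNReal.summable]
  have e : (2 : ℝ) / x = 1 / x + 1 / x := by ring
  rw [e, ENNReal.ofReal_add (by positivity) (by positivity)]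
  refine add_le_add (le_trans (le_of_eq ?_) h0) (le_trans (le_of_eq ?_) h0)
  · rw [Nat.cast_zero, if_pos rfl, zero_add]
    refine tsum_congr fun n => ?_
    rw [if_neg (by omega)]
    push_cast
    rw [abs_of_nonneg (by positivity)]
  · refine tsum_congr fun n => ?_
    rw [if_neg (by omega)]
    push_cast
    rw [abs_of_nonpos (by linarith [(Nat.cast_nonneg n : (0 : ℝ) ≤ n)])]
    ring_nf

/-- A family of reals which avoids `[-δ, δ]` and whose members are more than `δ` apart. -/
theorem tsum_one_div_one_add_mul_abs_sq_le_of_separated {ι : Type*} {r : ι → ℝ} {δ N : ℝ}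
    (hδ : 0 < δ) (hN : 0 < N) (h0 : ∀ i, δ < |r i|) (hr : ∀ i j, i ≠ j → δ < |r i - r j|) :
    ∑' i, ENNReal.ofReal (1 / (1 + N * |r i|) ^ 2) ≤ ENNReal.ofReal (4 / (N * δ)) := by
  have hfloor : ∀ i, (⌊r i / δ⌋ : ℝ) * δ ≤ r i ∧ r i < ((⌊r i / δ⌋ : ℝ) + 1) * δ := fun i =>
    ⟨(le_div_iff₀ hδ).1 (Int.floor_le _), (div_lt_iff₀ hδ).1 (Int.lt_floor_add_one _)⟩
  -- Each cell of length δ contains at most one point, so the sum can be compared with one over the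
  -- cell indices.
  have hinj : Function.Injective fun i => ⌊r i / δ⌋ := by
    intro i j hij
    by_contra hne
    have h1 := hr i j hne
    obtain ⟨a1, a2⟩ := hfloor i
    obtain ⟨b1, b2⟩ := hfloor j
    have hij' : (⌊r i / δ⌋ : ℝ) = ⌊r j / δ⌋ := by exact_mod_cast hij
    rw [hij'] at a1 a2
    have : |r i - r j| ≤ δ := abs_le.2 ⟨by linarith, by linarith⟩
    linarith
  have hx : 0 < N * δ / 2 := by positivity
  have h2 := tsum_int_one_div_one_add_mul_abs_sq_le hx
  have e : 2 / (N * δ / 2) = 4 / (N * δ) := by field_simp; norm_num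
  rw [e] at h2
  refine le_trans ?_ ((ENNReal.tsum_comp_le_tsum_of_injective hinj _).trans h2)
  refine ENNReal.tsum_le_tsum fun i => ?_
  obtain ⟨a1, a2⟩ := hfloor i
  have hi := h0 i
  set j : ℤ := ⌊r i / δ⌋ with hj
  have hj0 : j ≠ 0 := by
    intro h
    rw [h, Int.cast_zero] at a1 a2
    have : |r i| ≤ δ := abs_le.2 ⟨by linarith, by linarith⟩
    linarith
  -- In a negative cell only |r i| > (|j| - 1)δ is available, since the floor rounds away from zero;
  -- adding δ < |r i| gives the factor 2.
  have hle : δ * |(j : ℝ)| ≤ 2 * |r i| := by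
    rcases lt_or_gt_of_ne hj0 with hneg | hpos
    · have h1 : (j : ℝ) ≤ -1 := by exact_mod_cast Int.le_sub_one_of_lt hneg
      have hr0 : r i < 0 := lt_of_lt_of_le a2 (mul_nonpos_of_nonpos_of_nonneg (by linarith) hδ.le)
      rw [abs_of_neg hr0] at hi ⊢
      rw [abs_of_nonpos (by linarith)]
      nlinarith
    · have h1 : (1 : ℝ) ≤ j := by exact_mod_cast hpos
      have hr0 : 0 ≤ r i := le_trans (by positivity) a1
      rw [abs_of_nonneg hr0, abs_of_nonneg (by linarith)]
      nlinarith
  simp only [if_neg hj0]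
  refine ENNReal.ofReal_le_ofReal ?_
  have := mul_le_mul_of_nonneg_left hle hN.le
  have h3 : N * δ / 2 * |(j : ℝ)| ≤ N * |r i| := by linarith
  gcongr

theorem one_le_prod_fin {f : Fin d → ℝ} (hf : ∀ i, 1 ≤ f i) : 1 ≤ ∏ i, f i :=
  calc (1 : ℝ) = ∏ _i : Fin d, 1 := by simp
    _ ≤ _ := Finset.prod_le_prod (fun _ _ => zero_le_one) fun i _ => hf i

theorem one_le_mulHeight (m : Fin d → ℝ) : 1 ≤ mulHeight m :=
  one_le_prod_fin fun _ => le_max_left _ _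

theorem mulHeight_le_prod {m M : Fin d → ℝ} (h1 : ∀ i, 1 ≤ M i) (h : ∀ i, |m i| ≤ M i) :
    mulHeight m ≤ ∏ i, M i :=
  Finset.prod_le_prod (fun _ _ => by positivity) fun i _ => max_le (h1 i) (h i)

theorem DualBadlyApproximable.one_div_lt_distInt {φ : ℝ → ℝ} {α : Fin d → ℝ}
    (hα : DualBadlyApproximable φ α) (hmono : MonotoneOn φ (Set.Ici 1))
    (hone : ∀ x, 1 ≤ x → 1 ≤ φ x) {m : Fin d → ℤ} (hm : m ≠ 0) {Q : ℝ}
    (hQ : mulHeight (fun i => (m i : ℝ)) ≤ Q) :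
    1 / (Q * φ Q) < distInt (∑ i, (m i : ℝ) * α i) := by
  refine lt_of_le_of_lt ?_ (hα m hm)
  have h1 := one_le_mulHeight fun i => (m i : ℝ)
  have h2 := hone _ h1
  have h3 : φ (mulHeight fun i => (m i : ℝ)) ≤ φ Q := hmono h1 (h1.trans hQ) hQ
  have h4 : 0 ≤ Q := by linarith
  gcongr

/-- The nonzero integer points of a box. -/
def puncturedBox (M : Fin d → ℝ) : Set (Fin d → ℤ) := {m | m ≠ 0 ∧ ∀ i, |(m i : ℝ)| ≤ M i}

/-- The signed residues of m·α and m'·α differ from (m - m')·α by an integer, so their distance is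
at least ‖(m - m')·α‖. As m - m' lies in the doubled box, its height is at most Q = ∏ 2M_i, and the
gap is 1/(Qφ(Q)). -/
theorem DualBadlyApproximable.tsum_puncturedBox_le {φ : ℝ → ℝ} {α : Fin d → ℝ}
    (hα : DualBadlyApproximable φ α) (hmono : MonotoneOn φ (Set.Ici 1))
    (hone : ∀ x, 1 ≤ x → 1 ≤ φ x) {M : Fin d → ℝ} (hM : ∀ i, 1 ≤ M i) {N : ℝ} (hN : 0 < N) :
    ∑' m : puncturedBox M,
        ENNReal.ofReal (1 / (1 + N * distInt (∑ i, (m.1 i : ℝ) * α i)) ^ 2) ≤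
      ENNReal.ofReal (4 * ((2 ^ d * ∏ i, M i) * φ (2 ^ d * ∏ i, M i)) / N) := by
  set Q : ℝ := 2 ^ d * ∏ i, M i with hQ
  have hQ' : Q = ∏ i, 2 * M i := by rw [Finset.prod_mul_distrib]; simp [hQ]
  have hM1 : ∀ i, 1 ≤ 2 * M i := fun i => by linarith [hM i]
  have hQ1 : 1 ≤ Q := hQ'.symm ▸ one_le_prod_fin hM1
  have hφ := hone Q hQ1
  have hδ : 0 < 1 / (Q * φ Q) := by positivity
  have key := tsum_one_div_one_add_mul_abs_sq_le_of_separated (ι := puncturedBox M)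
    (r := fun m => ∑ i, (m.1 i : ℝ) * α i - round (∑ i, (m.1 i : ℝ) * α i)) hδ hN ?_ ?_
  · refine key.trans (le_of_eq ?_)
    congr 1
    field_simp
  · intro m
    refine hα.one_div_lt_distInt hmono hone m.2.1 ?_
    rw [hQ']
    exact mulHeight_le_prod hM1 fun i => (m.2.2 i).trans (by linarith [hM i])
  · intro m m' hne
    have hne' : m.1 - m'.1 ≠ 0 := sub_ne_zero.2 fun h => hne (Subtype.ext h)
    have h1 : 1 / (Q * φ Q) < distInt (∑ i, ((m.1 - m'.1) i : ℝ) * α i) := by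
      refine hα.one_div_lt_distInt hmono hone hne' ?_
      rw [hQ']
      refine mulHeight_le_prod hM1 fun i => ?_
      have a := m.2.2 i
      have b := m'.2.2 i
      simp only [Pi.sub_apply, Int.cast_sub]
      linarith [abs_sub (m.1 i : ℝ) (m'.1 i)]
    refine h1.trans_le ((distInt_le _ (round (∑ i, (m.1 i : ℝ) * α i) -
      round (∑ i, (m'.1 i : ℝ) * α i))).trans (le_of_eq ?_))
    congr 1
    simp only [Pi.sub_apply, Int.cast_sub, sub_mul, Finset.sum_sub_distrib]
    ring

/-! ### Dyadic decomposition and the bound in terms of the volume -/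

theorem exists_le_two_pow_and_one_div_le (ℓ : ℕ) {t : ℝ} (ht : 0 ≤ t) :
    ∃ j : ℕ, t ≤ 2 ^ j ∧ 1 / (1 + t) ^ ℓ ≤ 2 ^ ℓ * (1 / 2 ^ ℓ) ^ j := by
  obtain ⟨n, h1, h2⟩ := exists_nat_pow_near (x := 1 + t) (by linarith) one_lt_two
  refine ⟨n + 1, by linarith, ?_⟩
  have : (2 : ℝ) ^ ℓ * (1 / 2 ^ ℓ) ^ (n + 1) = 1 / (2 ^ n) ^ ℓ := by
    rw [pow_succ, div_pow, one_pow, ← pow_mul, ← pow_mul, mul_comm ℓ n]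
    field_simp
  rw [this]
  gcongr

/-- Dyadic decomposition of the weight `∏ (1 + ρ_i |m_i|) ^ (-ℓ)`. -/
theorem tsum_ne_zero_le_tsum_puncturedBox (ℓ : ℕ) {ρ : Fin d → ℝ} (hρ : ∀ i, 0 < ρ i)
    {g : (Fin d → ℤ) → ℝ} (hg : ∀ m, 0 ≤ g m) :
    ∑' m : {m : Fin d → ℤ // m ≠ 0},
        ENNReal.ofReal ((∏ i, 1 / (1 + ρ i * |(m.1 i : ℝ)|) ^ ℓ) * g m) ≤
      ∑' j : Fin d → ℕ, ENNReal.ofReal ((2 ^ ℓ) ^ d * (1 / 2 ^ ℓ) ^ (∑ i, j i)) *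
        ∑' m : puncturedBox (fun i => 2 ^ j i / ρ i), ENNReal.ofReal (g m) := by
  set c : (Fin d → ℕ) → ENNReal := fun j =>
    ENNReal.ofReal ((2 ^ ℓ) ^ d * (1 / 2 ^ ℓ) ^ (∑ i, j i)) with hc
  have e : ∀ j : Fin d → ℕ, c j * ∑' m : puncturedBox (fun i => 2 ^ j i / ρ i),
      ENNReal.ofReal (g m) = ∑' m, (puncturedBox fun i => 2 ^ j i / ρ i).indicator
        (fun m => c j * ENNReal.ofReal (g m)) m := by
    intro j
    rw [← ENNReal.tsum_mul_left]
    exact tsum_subtype (puncturedBox fun i => 2 ^ j i / ρ i) fun m => c j * ENNReal.ofReal (g m)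
  rw [tsum_congr e, ENNReal.tsum_comm]
  have e2 := tsum_subtype {m : Fin d → ℤ | m ≠ 0} fun m =>
    ENNReal.ofReal ((∏ i, 1 / (1 + ρ i * |(m i : ℝ)|) ^ ℓ) * g m)
  refine e2.trans_le (ENNReal.tsum_le_tsum fun m => ?_)
  refine Set.indicator_apply_le' (fun hm => ?_) fun _ => zero_le
  have hex := fun i => exists_le_two_pow_and_one_div_le ℓ
    (t := ρ i * |(m i : ℝ)|) (mul_nonneg (hρ i).le (abs_nonneg _))
  choose j hj1 hj2 using hex
  -- The dyadic boxes are nested rather than disjoint, but a single box containing m, at its own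
  -- scale j, already accounts for the weight of m.
  refine le_trans ?_ (ENNReal.le_tsum j)
  rw [Set.indicator_of_mem]
  · rw [hc, ← ENNReal.ofReal_mul (by positivity)]
    refine ENNReal.ofReal_le_ofReal (mul_le_mul_of_nonneg_right ?_ (hg m))
    refine (Finset.prod_le_prod (fun i _ => ?_) fun i _ => hj2 i).trans (le_of_eq ?_)
    · have := hρ i
      positivity
    · rw [Finset.prod_mul_distrib, Finset.prod_const, Finset.prod_pow_eq_pow_sum,
        Finset.card_univ, Fintype.card_fin]
  · refine ⟨hm, fun i => ?_⟩
    rw [le_div_iff₀ (hρ i), mul_comm]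
    exact hj1 i

theorem summable_half_pow_sum (d : ℕ) : Summable fun j : Fin d → ℕ => (1 / 2 : ℝ) ^ ∑ i, j i := by
  have := (summable_norm_prod_and_prod_tsum (d := d) (f := fun _ (j : ℕ) => (1 / 2 : ℂ) ^ j)
    fun i => by simpa using summable_geometric_two).1
  refine this.congr fun j => ?_
  rw [Finset.prod_pow_eq_pow_sum]
  simp

/-- The bound for the smooth discrepancy of a box that comes from Poisson summation. -/
theorem DualBadlyApproximable.exists_abs_boxDiscrepancy_le {φ : ℝ → ℝ} {α : Fin d → ℝ}
    (hα : DualBadlyApproximable φ α) (hmono : MonotoneOn φ (Set.Ici 1))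
    (hone : ∀ x, 1 ≤ x → 1 ≤ φ x) {q : ℕ} {B : ℝ}
    (hgrow : ∀ (t : ℕ) (x : ℝ), 1 ≤ x → φ (2 ^ t * x) ≤ B * (2 ^ q) ^ t * φ x)
    {ω : Fin (d + 1) → ℝ → ℝ} {A : ℝ} (hω : ∀ i, HasFourierDecay (q + 2) A (ω i)) :
    ∃ C : ℝ, 0 ≤ C ∧ ∀ (γ ρ : Fin d → ℝ), (∀ i, 0 < ρ i) → (∀ i, ρ i ≤ 1) → ∀ N : ℝ, 1 ≤ N →
      |boxDiscrepancy ω α γ ρ N| ≤ C * φ (∏ i, ρ i)⁻¹ := by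
  obtain ⟨C₁, hC₁, h⟩ := ofReal_abs_boxDiscrepancy_le hω (by omega)
  have hB : 0 ≤ B := by
    have h1 := hgrow 0 1 le_rfl
    have h2 := hone 1 le_rfl
    simp only [pow_zero, mul_one] at h1
    nlinarith
  set S : ℝ := ∑' j : Fin d → ℕ, (1 / 2 : ℝ) ^ ∑ i, j i with hS
  have hS0 : 0 ≤ S := tsum_nonneg fun j => by positivity
  set K : ℝ := (2 ^ (q + 2)) ^ d * 4 * B * (2 * 2 ^ q) ^ d with hK
  have hK0 : 0 ≤ K := by positivity
  refine ⟨C₁ + C₁ * (K * S), by positivity, fun γ ρ hρ hρ1 N hN => ?_⟩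
  have hN0 : 0 < N := by linarith
  have hP : 0 < ∏ i, ρ i := Finset.prod_pos fun i _ => hρ i
  have hP1 : 1 ≤ (∏ i, ρ i)⁻¹ :=
    one_le_inv_iff₀.2 ⟨hP, Finset.prod_le_one (fun i _ => (hρ i).le) fun i _ => hρ1 i⟩
  set P : ℝ := (∏ i, ρ i)⁻¹ with hPdef
  have hφ : 1 ≤ φ P := hone P hP1
  have hterm : ∀ j : Fin d → ℕ,
      ENNReal.ofReal ((2 ^ (q + 2)) ^ d * (1 / 2 ^ (q + 2)) ^ (∑ i, j i)) *
        ∑' m : puncturedBox (fun i => 2 ^ j i / ρ i),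
          ENNReal.ofReal (1 / (1 + N * distInt (∑ i, (m.1 i : ℝ) * α i)) ^ 2) ≤
      ENNReal.ofReal (K * (P * φ P / N)) * ENNReal.ofReal ((1 / 2 : ℝ) ^ ∑ i, j i) := by
    intro j
    have hbox := hα.tsum_puncturedBox_le hmono hone (M := fun i => 2 ^ j i / ρ i)
      (fun i => (one_le_div (hρ i)).2 ((hρ1 i).trans (one_le_pow₀ one_le_two))) hN0
    refine (mul_le_mul_right hbox _).trans ?_
    rw [← ENNReal.ofReal_mul (by positivity), ← ENNReal.ofReal_mul (by positivity)]
    refine ENNReal.ofReal_le_ofReal ?_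
    have e : (2 : ℝ) ^ d * ∏ i, 2 ^ j i / ρ i = 2 ^ (d + ∑ i, j i) * P := by
      rw [Finset.prod_div_distrib, Finset.prod_pow_eq_pow_sum, pow_add, hPdef]
      ring
    rw [e]
    have hg := hgrow (d + ∑ i, j i) P hP1
    set s : ℕ := ∑ i, j i
    calc (2 ^ (q + 2)) ^ d * (1 / 2 ^ (q + 2)) ^ s *
          (4 * (2 ^ (d + s) * P * φ (2 ^ (d + s) * P)) / N)
        ≤ (2 ^ (q + 2)) ^ d * (1 / 2 ^ (q + 2)) ^ s *
          (4 * (2 ^ (d + s) * P * (B * (2 ^ q) ^ (d + s) * φ P)) / N) := by gcongr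
      _ = K * (P * φ P / N) * ((1 / 2 ^ (q + 2)) ^ s * 2 ^ s * (2 ^ q) ^ s) := by
          rw [hK]; ring
      -- Balance of the exponent q + 2: the growth of φ costs 2^(qs), the volume of the box costs
      -- 2^s, and the last factor 2^(-s) makes the sum over j converge.
      _ = K * (P * φ P / N) * (1 / 2) ^ s := by
          rw [← mul_pow, ← mul_pow]
          congr 2
          rw [pow_add]
          field_simp
  have hsum : ∑' m : {m : Fin d → ℤ // m ≠ 0},
      ENNReal.ofReal ((∏ i, 1 / (1 + ρ i * |(m.1 i : ℝ)|) ^ (q + 2)) *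
        (1 / (1 + N * distInt (∑ i, (m.1 i : ℝ) * α i)) ^ 2)) ≤
      ENNReal.ofReal (K * (P * φ P / N) * S) := by
    refine (tsum_ne_zero_le_tsum_puncturedBox (q + 2) hρ
      (g := fun m => 1 / (1 + N * distInt (∑ i, (m i : ℝ) * α i)) ^ 2)
      fun m => by positivity).trans ?_
    refine (ENNReal.tsum_le_tsum hterm).trans (le_of_eq ?_)
    rw [ENNReal.tsum_mul_left, ENNReal.ofReal_mul (p := K * (P * φ P / N)) (by positivity), hS,
      ENNReal.ofReal_tsum_of_nonneg (fun j => by positivity) (summable_half_pow_sum d)]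
  have hfin := (h α γ ρ hρ hρ1 N hN).trans (add_le_add le_rfl (mul_le_mul_right hsum _))
  rw [← ENNReal.ofReal_mul (by positivity), ← ENNReal.ofReal_add hC₁ (by positivity),
    ENNReal.ofReal_le_ofReal_iff (by positivity)] at hfin
  refine hfin.trans ?_
  have e : C₁ * ((∏ i, ρ i) * N) * (K * (P * φ P / N) * S) = C₁ * (K * S) * φ P := by
    rw [hPdef]
    field_simp
  rw [e, add_mul]
  gcongr
  exact le_mul_of_one_le_right hC₁ hφ

/-! ### Small boxes by enlargement -/

theorem exists_enlarged_box {ρ : Fin d → ℝ} (hρ : ∀ i, 0 < ρ i) (hρ1 : ∀ i, ρ i ≤ 1) {Λ : ℝ}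
    (hΛ : 1 ≤ Λ) (hP : Λ < (∏ i, ρ i)⁻¹) :
    ∃ ρ' : Fin d → ℝ, (∀ i, ρ i ≤ ρ' i) ∧ (∀ i, ρ' i ≤ 1) ∧ ∏ i, ρ' i = Λ⁻¹ := by
  have hprod : 0 < ∏ i, ρ i := Finset.prod_pos fun i _ => hρ i
  have hlog : 0 < Real.log (∏ i, ρ i)⁻¹ := Real.log_pos (hΛ.trans_lt hP)
  have hΛ0 : 0 < Λ := by linarith
  -- Raising every side to the same power t ∈ [0, 1] lengthens it while keeping it at most 1; t is
  -- fixed by the required volume.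
  set t : ℝ := Real.log Λ / Real.log (∏ i, ρ i)⁻¹ with ht
  have ht0 : 0 ≤ t := div_nonneg (Real.log_nonneg hΛ) hlog.le
  have ht1 : t ≤ 1 := (div_le_one hlog).2 (Real.log_le_log hΛ0 hP.le)
  refine ⟨fun i => ρ i ^ t, fun i => ?_, fun i => Real.rpow_le_one (hρ i).le (hρ1 i) ht0, ?_⟩
  · simpa using Real.rpow_le_rpow_of_exponent_ge (hρ i) (hρ1 i) ht1
  · rw [Real.finsetProd_rpow _ _ fun i _ => (hρ i).le, Real.rpow_def_of_pos hprod,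
      ← Real.exp_log (inv_pos.2 hΛ0), Real.log_inv]
    congr 1
    rw [ht, Real.log_inv] at *
    have : Real.log (∏ i, ρ i) ≠ 0 := by linarith
    field_simp

/-- Lengthening the sides shrinks the arguments of the weights. Wherever ω is nonzero, χ equals 1 at
the smaller argument, so b·χ dominates ω termwise. -/
theorem tsum_pointWeight_le_of_le {ω χ : Fin (d + 1) → ℝ → ℝ} {b : ℝ}
    (hω0 : ∀ i x, 0 ≤ ω i x) (hωs : ∀ i x, ω i x ≠ 0 → |x| ≤ 2) (hωc : ∀ i, HasCompactSupport (ω i))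
    (hωb : ∀ i x, ω i x ≤ b) (hχ0 : ∀ i x, 0 ≤ χ i x) (hχ1 : ∀ i x, |x| ≤ 2 → χ i x = 1)
    (hχc : ∀ i, HasCompactSupport (χ i)) (α γ : Fin d → ℝ) {ρ ρ' : Fin d → ℝ} (hρ : ∀ i, 0 < ρ i)
    (hρ' : ∀ i, ρ i ≤ ρ' i) {N : ℝ} (hN : 0 < N) :
    ∑' a, pointWeight ω α γ ρ N a ≤ b ^ (d + 1) * ∑' a, pointWeight χ α γ ρ' N a := by
  have hb : 0 ≤ b := (hω0 0 0).trans (hωb 0 0)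
  have hρ0 : ∀ i, 0 < ρ' i := fun i => (hρ i).trans_le (hρ' i)
  have hle : ∀ i x y, |y| ≤ |x| → ω i x ≤ b * χ i y := by
    intro i x y hxy
    by_cases h : ω i x = 0
    · rw [h]
      exact mul_nonneg hb (hχ0 i y)
    · rw [hχ1 i y (hxy.trans (hωs i x h)), mul_one]
      exact hωb i x
  rw [← tsum_mul_left]
  refine Summable.tsum_le_tsum (fun a => ?_)
    (summable_of_hasFiniteSupport (finite_support_pointWeight hωc α γ ρ hρ hN))
    ((summable_of_hasFiniteSupport (finite_support_pointWeight hχc α γ ρ' hρ0 hN)).mul_left _)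
  have h1 := hle (Fin.last d) (a (Fin.last d) / N) _ le_rfl
  have h2 : ∏ i : Fin d, ω i.castSucc
      (((a i.castSucc : ℝ) + (a (Fin.last d) : ℝ) * α i - γ i) / ρ i) ≤
      ∏ i : Fin d, b * χ i.castSucc
      (((a i.castSucc : ℝ) + (a (Fin.last d) : ℝ) * α i - γ i) / ρ' i) := by
    refine Finset.prod_le_prod (fun i _ => hω0 _ _) fun i _ => hle _ _ _ ?_
    rw [abs_div, abs_div, abs_of_pos (hρ i), abs_of_pos (hρ0 i)]
    exact div_le_div_of_nonneg_left (abs_nonneg _) (hρ i) (hρ' i)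
  rw [Finset.prod_mul_distrib, Finset.prod_const, Finset.card_univ, Fintype.card_fin] at h2
  refine (mul_le_mul h1 h2 (Finset.prod_nonneg fun i _ => hω0 _ _)
    (mul_nonneg hb (hχ0 _ _))).trans (le_of_eq ?_)
  rw [pointWeight, pow_succ]
  ring

theorem IsWeight.hasCompactSupport {k ℓ : ℕ} {ω : Fin k → ℝ → ℝ} (hω : IsWeight ℓ ω) (i : Fin k) :
    HasCompactSupport (ω i) :=
  isCompact_Icc.of_isClosed_subset (isClosed_tsupport _) (hω.supp i)

theorem IsWeight.exists_hasFourierDecay {k ℓ : ℕ} {ω : Fin k → ℝ → ℝ} (hω : IsWeight ℓ ω) :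
    ∃ A, ∀ i, HasFourierDecay ℓ A (ω i) := by
  choose A hA using fun i => SmoothDisc.exists_hasFourierDecay (hω.smooth i) (hω.hasCompactSupport i)
  exact ⟨∑ i, A i, fun i => (hA i).mono
    (Finset.single_le_sum (fun j _ => (hA j).const_nonneg) (Finset.mem_univ i))⟩

theorem IsWeight.exists_le {k ℓ : ℕ} {ω : Fin k → ℝ → ℝ} (hω : IsWeight ℓ ω) :
    ∃ b, ∀ i x, ω i x ≤ b := by
  choose b hb using fun i =>
    (hω.hasCompactSupport i).exists_bound_of_continuous (hω.smooth i).continuous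
  refine ⟨∑ i, b i, fun i x => (le_abs_self _).trans ((hb i x).trans ?_)⟩
  exact Finset.single_le_sum (fun j _ => (norm_nonneg _).trans (hb j 0)) (Finset.mem_univ i)

/-- A box of volume below `1 / Λ` is compared with a box of volume `1 / Λ` which contains it. -/
theorem DualBadlyApproximable.exists_abs_boxDiscrepancy_le_add {φ : ℝ → ℝ} {α : Fin d → ℝ}
    (hα : DualBadlyApproximable φ α) (hmono : MonotoneOn φ (Set.Ici 1))
    (hone : ∀ x, 1 ≤ x → 1 ≤ φ x) {q : ℕ} {B : ℝ}
    (hgrow : ∀ (t : ℕ) (x : ℝ), 1 ≤ x → φ (2 ^ t * x) ≤ B * (2 ^ q) ^ t * φ x)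
    {ω : Fin (d + 1) → ℝ → ℝ} (hω : IsWeight (q + 2) ω) :
    ∃ C : ℝ, 0 ≤ C ∧ ∀ (γ ρ : Fin d → ℝ), (∀ i, 0 < ρ i) → (∀ i, ρ i ≤ 1) →
      ∀ N : ℝ, 1 ≤ N → ∀ Λ : ℝ, 1 ≤ Λ →
      |boxDiscrepancy ω α γ ρ N| ≤ C * (φ Λ + N / Λ) := by
  -- The majorant is 1 on [-2, 2], hence on the supports of all ω_i. It need not be a weight of the
  -- class: the volume bound asks only for Fourier decay.
  let f : ContDiffBump (0 : ℝ) := ⟨2, 3, by norm_num, by norm_num⟩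
  set χ : Fin (d + 1) → ℝ → ℝ := fun _ => f with hχ
  obtain ⟨A, hA⟩ := hω.exists_hasFourierDecay
  obtain ⟨A', hA'⟩ := exists_hasFourierDecay (ℓ := q + 2) f.contDiff f.hasCompactSupport
  obtain ⟨b, hb⟩ := hω.exists_le
  obtain ⟨C₁, hC₁, h₁⟩ := hα.exists_abs_boxDiscrepancy_le hmono hone hgrow hA
  obtain ⟨C₂, hC₂, h₂⟩ := hα.exists_abs_boxDiscrepancy_le hmono hone hgrow (ω := χ)
    fun _ => hA'
  have hb0 : 0 ≤ b := (hω.nonneg 0 0).trans (hb 0 0)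
  have hw : 0 ≤ weightConst ω := Finset.prod_nonneg fun i _ => (hω.fourier_zero_pos i).le
  refine ⟨C₁ + b ^ (d + 1) * (C₂ + |weightConst χ|) + weightConst ω, by positivity,
    fun γ ρ hρ hρ1 N hN Λ hΛ => ?_⟩
  have hN0 : 0 < N := by linarith
  have hΛ0 : 0 < Λ := by linarith
  have hφ := hone Λ hΛ
  have hP : 0 < ∏ i, ρ i := Finset.prod_pos fun i _ => hρ i
  have hND : 0 < N / Λ := by positivity
  set X : ℝ := φ Λ + N / Λ with hX
  have hX0 : 0 < X := by positivity
  have hbC : 0 ≤ b ^ (d + 1) * (C₂ + |weightConst χ|) * X := by positivity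
  have hwX : 0 ≤ weightConst ω * X := by positivity
  have hCX : 0 ≤ C₁ * X := by positivity
  rw [add_mul, add_mul]
  -- A large box is handled by monotonicity of φ. For a small box the count and the expected value
  -- are both non-negative and O(X), so no cancellation between them is needed.
  rcases le_or_gt (∏ i, ρ i)⁻¹ Λ with hle | hlt
  · have h3 : φ (∏ i, ρ i)⁻¹ ≤ X := by
      have hP1 : 1 ≤ (∏ i, ρ i)⁻¹ :=
        one_le_inv_iff₀.2 ⟨hP, Finset.prod_le_one (fun i _ => (hρ i).le) fun i _ => hρ1 i⟩
      have := hmono hP1 hΛ hle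
      linarith
    have h4 := (h₁ γ ρ hρ hρ1 N hN).trans (mul_le_mul_of_nonneg_left h3 hC₁)
    linarith
  · obtain ⟨ρ', hρρ', hρ'1, hprod⟩ := exists_enlarged_box hρ hρ1 hΛ hlt
    have hρ'0 : ∀ i, 0 < ρ' i := fun i => (hρ i).trans_le (hρρ' i)
    have hcomp := tsum_pointWeight_le_of_le (ω := ω) (χ := χ) hω.nonneg
      (fun i x hx => abs_le.2 (hω.supp i (subset_tsupport _ hx))) hω.hasCompactSupport hb
      (fun _ x => f.nonneg)
      (fun _ x hx => f.one_of_mem_closedBall (by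
        rw [mem_closedBall_zero_iff, Real.norm_eq_abs]; exact hx))
      (fun _ => f.hasCompactSupport) α γ hρ hρρ' hN0
    have h3 := (abs_le.1 (h₂ γ ρ' hρ'0 hρ'1 N hN)).2
    rw [hprod, inv_inv, boxDiscrepancy, hprod] at h3
    have e : Λ⁻¹ * N = N / Λ := by rw [div_eq_mul_inv, mul_comm]
    rw [e] at h3
    have h4 : weightConst χ * (N / Λ) ≤ |weightConst χ| * X :=
      mul_le_mul (le_abs_self _) (by linarith) hND.le (abs_nonneg _)
    have h5 : C₂ * φ Λ ≤ C₂ * X := mul_le_mul_of_nonneg_left (by linarith) hC₂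
    have h6 : ∑' a, pointWeight χ α γ ρ' N a ≤ (C₂ + |weightConst χ|) * X := by linarith
    have h7 := hcomp.trans (mul_le_mul_of_nonneg_left h6 (pow_nonneg hb0 (d + 1)))
    have h8 : 0 ≤ ∑' a, pointWeight ω α γ ρ N a := tsum_nonneg fun a =>
      mul_nonneg (hω.nonneg _ _) (Finset.prod_nonneg fun i _ => hω.nonneg _ _)
    have h9 : weightConst ω * ((∏ i, ρ i) * N) ≤ weightConst ω * X := by
      refine mul_le_mul_of_nonneg_left ?_ hw
      have : (∏ i, ρ i) * N ≤ Λ⁻¹ * N :=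
        mul_le_mul_of_nonneg_right ((lt_inv_comm₀ hΛ0 hP).1 hlt).le hN0.le
      linarith
    have h10 : 0 ≤ weightConst ω * ((∏ i, ρ i) * N) := by positivity
    rw [boxDiscrepancy, abs_le]
    constructor <;> linarith

/-! ### Growth of φ, the function L, and badly approximable numbers -/

theorem smoothDiscrepancy_le_ofReal {ω : Fin (d + 1) → ℝ → ℝ} {α : Fin d → ℝ} {N K : ℝ}
    (h : ∀ γ ρ : Fin d → ℝ, (∀ i, 0 < ρ i) → (∀ i, ρ i ≤ 1) → |boxDiscrepancy ω α γ ρ N| ≤ K) :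
    smoothDiscrepancy ω α N ≤ ENNReal.ofReal K :=
  iSup_le fun γ => iSup_le fun ρ => iSup_le fun hρ => ENNReal.ofReal_le_ofReal
    (h γ ρ (fun i => (hρ i).1) fun i => by linarith [(hρ i).2])

/-- Doubling is iterated once the argument has passed a threshold y. Below y, the doubled argument
is at most 2y, so monotonicity and the constant φ(2y) suffice. -/
theorem exists_growth_bound {φ : ℝ → ℝ} (hmono : MonotoneOn φ (Set.Ici 1))
    (hone : ∀ x, 1 ≤ x → 1 ≤ φ x) {K : ℝ} (hK : 1 ≤ K)
    (h : ∀ᶠ x in Filter.atTop, φ (2 * x) ≤ K * φ x) :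
    ∃ B : ℝ, ∀ (t : ℕ) (x : ℝ), 1 ≤ x → φ (2 ^ t * x) ≤ B * K ^ t * φ x := by
  obtain ⟨x₀, hx₀⟩ := Filter.eventually_atTop.1 h
  set y : ℝ := max 1 x₀ with hy
  have hy1 : 1 ≤ y := le_max_left _ _
  have hB : 1 ≤ φ (2 * y) := hone _ (by linarith)
  refine ⟨φ (2 * y), fun t x hx => ?_⟩
  have hφx := hone x hx
  induction t with
  | zero =>
    simp only [pow_zero, one_mul, mul_one]
    exact le_mul_of_one_le_left (by linarith) hB
  | succ t ih =>
    have h1 : 1 ≤ 2 ^ t * x := one_le_mul_of_one_le_of_one_le (one_le_pow₀ one_le_two) hx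
    rw [pow_succ', mul_assoc]
    rcases le_total y (2 ^ t * x) with hle | hle
    · refine (hx₀ _ ((le_max_right _ _).trans hle)).trans ?_
      have := mul_le_mul_of_nonneg_left ih (zero_le_one.trans hK)
      refine this.trans (le_of_eq ?_)
      ring
    · refine (hmono (Set.mem_Ici.2 (by linarith)) (Set.mem_Ici.2 (by linarith))
        (by linarith : 2 * (2 ^ t * x) ≤ 2 * y)).trans ?_
      rw [mul_assoc]
      exact le_mul_of_one_le_right (by linarith)
        (one_le_mul_of_one_le_of_one_le (one_le_pow₀ hK) hφx)

theorem one_le_of_limsup_eq {φ : ℝ → ℝ} (hmono : MonotoneOn φ (Set.Ici 1))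
    (hone : ∀ x, 1 ≤ x → 1 ≤ φ x) {ξ : ℝ}
    (hξ : Filter.limsup (fun x : ℝ => ((φ (2 * x) / φ x : ℝ) : EReal)) Filter.atTop =
      (ξ : EReal)) : 1 ≤ ξ := by
  have : ((1 : ℝ) : EReal) ≤ ξ := by
    rw [← hξ]
    refine Filter.le_limsup_of_frequently_le (Filter.Eventually.frequently ?_)
    filter_upwards [Filter.eventually_ge_atTop (1 : ℝ)] with x hx
    have := hone x hx
    exact EReal.coe_le_coe_iff.2 ((one_le_div (by linarith)).2
      (hmono (Set.mem_Ici.2 hx) (Set.mem_Ici.2 (by linarith)) (by linarith)))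
  exact_mod_cast this

/-- Twice the supremum exceeds it and so fails the defining inequality. Passing to 2L avoids any
question of continuity of φ at L; the growth condition later absorbs the factor 2. -/
theorem invHeight_spec {φ : ℝ → ℝ} (hone : ∀ x, 1 ≤ x → 1 ≤ φ x) {N : ℝ} (hN : φ 1 ≤ N) :
    1 ≤ invHeight φ N ∧ N < 2 * invHeight φ N * φ (2 * invHeight φ N) := by
  have hbdd : BddAbove {H : ℝ | 1 ≤ H ∧ H * φ H ≤ N} := by
    refine ⟨N, fun H hH => ?_⟩
    have := hone H hH.1
    have h1 := hH.1
    have h2 := hH.2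
    nlinarith
  have h1 : 1 ≤ invHeight φ N := le_csSup hbdd ⟨le_rfl, by linarith⟩
  refine ⟨h1, ?_⟩
  by_contra! hle
  have : 2 * invHeight φ N ≤ invHeight φ N := le_csSup hbdd ⟨by linarith, hle⟩
  linarith

theorem distInt_neg (x : ℝ) : distInt (-x) = distInt x := by
  have key : ∀ y : ℝ, distInt (-y) ≤ distInt y := fun y =>
    (distInt_le (-y) (-round y)).trans (le_of_eq (by
      rw [distInt, ← abs_neg]; congr 1; push_cast; ring))
  refine le_antisymm (key x) ?_
  simpa using key (-x)

theorem BadlyApproximable.dualBadlyApproximable {α : ℝ} (hα : BadlyApproximable α) :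
    ∃ c : ℝ, 1 ≤ c ∧ DualBadlyApproximable (d := 1) (fun _ => c) fun _ => α := by
  obtain ⟨c, hc, h⟩ := hα
  -- The 2 turns the weak inequality with c into the strict one required; the maximum with 1 keeps
  -- the constant function φ at least 1.
  refine ⟨max 1 (2 / c), le_max_left _ _, fun m hm => ?_⟩
  have hm0 : m 0 ≠ 0 := fun h0 => hm (by ext i; rw [Subsingleton.elim i 0, h0]; rfl)
  have h1 := one_le_abs_intCast hm0
  have hn : ((m 0).natAbs : ℝ) = |(m 0 : ℝ)| := by
    rw [Nat.cast_natAbs, Int.cast_abs]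
  have h2 := h (m 0).natAbs (Int.natAbs_pos.2 hm0)
  have h3 : distInt (((m 0).natAbs : ℝ) * α) = distInt ((m 0 : ℝ) * α) := by
    rw [hn]
    rcases abs_choice (m 0 : ℝ) with h4 | h4
    · rw [h4]
    · rw [h4, neg_mul, distInt_neg]
  rw [h3, hn] at h2
  simp only [mulHeight, Fin.prod_univ_one, Fin.sum_univ_one, max_eq_right h1]
  have hpos : 0 < |(m 0 : ℝ)| := by linarith
  have hmax : 2 / c ≤ max 1 (2 / c) := le_max_right _ _
  calc 1 / (|(m 0 : ℝ)| * max 1 (2 / c)) ≤ 1 / (|(m 0 : ℝ)| * (2 / c)) := by gcongr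
    _ = c / (2 * |(m 0 : ℝ)|) := by field_simp
    _ < c / |(m 0 : ℝ)| := div_lt_div_of_pos_left hc hpos (by linarith)
    _ ≤ distInt ((m 0 : ℝ) * α) := (div_le_iff₀' hpos).2 h2

end SmoothDisc

/-! ### Choice of Λ and conclusion -/

theorem theorem1p4 :
    (∀ (d : ℕ) (_ : 1 ≤ d) (α : Fin d → ℝ) (φ : ℝ → ℝ) (ξ : ℝ) (ℓ : ℕ)
      (ω : Fin (d + 1) → ℝ → ℝ),
      MonotoneOn φ (Set.Ici 1) →
      (∀ x, 1 ≤ x → 1 ≤ φ x) →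
      SmoothDisc.DualBadlyApproximable φ α →
      Filter.limsup (fun x : ℝ => ((φ (2 * x) / φ x : ℝ) : EReal)) Filter.atTop = (ξ : EReal) →
      SmoothDisc.IsWeight ℓ ω →
      2 + 2 * (Real.log ξ / Real.log 2) < (ℓ : ℝ) →
      ∃ C : ℝ, 0 < C ∧ ∀ N : ℝ, φ 1 ≤ N →
        SmoothDisc.smoothDiscrepancy ω α N ≤
          ENNReal.ofReal (C * φ (SmoothDisc.invHeight φ N))) ∧
    (∀ (α : ℝ) (ℓ : ℕ) (ω : Fin 2 → ℝ → ℝ),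
      SmoothDisc.BadlyApproximable α →
      3 ≤ ℓ →
      SmoothDisc.IsWeight ℓ ω →
      ∃ C : ℝ, 0 < C ∧ ∀ N : ℝ, 1 ≤ N →
        SmoothDisc.smoothDiscrepancy (d := 1) ω (fun _ => α) N ≤ ENNReal.ofReal C) := by
  constructor
  · intro d _ α φ ξ ℓ ω hmono hone hα hξ hω hℓ
    have hξ1 := SmoothDisc.one_le_of_limsup_eq hmono hone hξ
    have hlog2 : 0 < Real.log 2 := Real.log_pos one_lt_two
    have hr : 0 ≤ Real.log ξ / Real.log 2 := div_nonneg (Real.log_nonneg hξ1) hlog2.le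
    have hℓ2 : 2 ≤ ℓ := by
      have : (2 : ℝ) ≤ ℓ := by linarith
      exact_mod_cast this
    obtain ⟨q, rfl⟩ := Nat.exists_eq_add_of_le' hℓ2
    push_cast at hℓ
    -- With ℓ = q + 2 the smoothness condition reads q > 2 log ξ / log 2, and log ξ ≥ 0, so q
    -- exceeds log ξ / log 2.
    have hξq : ξ < 2 ^ q := by
      rw [← Real.log_lt_log_iff (by linarith) (by positivity), Real.log_pow,
        ← div_lt_iff₀ hlog2]
      linarith
    have hK : (1 : ℝ) ≤ 2 ^ q := one_le_pow₀ one_le_two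
    obtain ⟨B, hB⟩ := SmoothDisc.exists_growth_bound hmono hone hK (by
      have hlt : Filter.limsup (fun x : ℝ => ((φ (2 * x) / φ x : ℝ) : EReal)) Filter.atTop <
          ((2 ^ q : ℝ) : EReal) := by
        rw [hξ]
        exact EReal.coe_lt_coe_iff.2 hξq
      filter_upwards [Filter.eventually_lt_of_limsup_lt hlt,
        Filter.eventually_ge_atTop (1 : ℝ)] with x hx hx1
      have := hone x hx1
      exact ((div_lt_iff₀ (by linarith)).1 (EReal.coe_lt_coe_iff.1 hx)).le)
    obtain ⟨C, hC, h⟩ := hα.exists_abs_boxDiscrepancy_le_add hmono hone hB hω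
    have hB0 : 0 ≤ B := by
      have h1 := hB 0 1 le_rfl
      have h2 := hone 1 le_rfl
      simp only [pow_zero, mul_one] at h1
      nlinarith
    refine ⟨C * (1 + 2 * (B * 2 ^ q)) + 1, by positivity, fun N hN => ?_⟩
    obtain ⟨hL1, hL2⟩ := SmoothDisc.invHeight_spec hone hN
    have hN1 : 1 ≤ N := (hone 1 le_rfl).trans hN
    refine SmoothDisc.smoothDiscrepancy_le_ofReal fun γ ρ hρ hρ1 =>
      (h γ ρ hρ hρ1 N hN1 _ hL1).trans ?_
    set Λ : ℝ := SmoothDisc.invHeight φ N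
    have hφ := hone Λ hL1
    have h2 := hB 1 Λ hL1
    rw [pow_one, pow_one] at h2
    -- From N < 2Λ φ(2Λ) and one doubling φ(2Λ) ≤ B 2^q φ(Λ).
    have h3 : N / Λ ≤ 2 * (B * 2 ^ q * φ Λ) := by
      rw [div_le_iff₀ (by linarith)]
      have := mul_le_mul_of_nonneg_left h2 (by linarith : 0 ≤ 2 * Λ)
      linarith
    have h4 : C * (φ Λ + N / Λ) ≤ C * (φ Λ + 2 * (B * 2 ^ q * φ Λ)) := by gcongr
    linarith
  · intro α ℓ ω hα hℓ hω
    obtain ⟨q, rfl⟩ := Nat.exists_eq_add_of_le' (show 2 ≤ ℓ by omega)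
    obtain ⟨c, hc, hdual⟩ := hα.dualBadlyApproximable
    obtain ⟨C, hC, h⟩ := hdual.exists_abs_boxDiscrepancy_le_add (fun _ _ _ _ _ => le_rfl)
      (fun _ _ => hc) (q := q) (B := 1) (fun t x _ => by
        rw [one_mul]
        exact le_mul_of_one_le_left (by linarith) (one_le_pow₀ (one_le_pow₀ one_le_two))) hω
    -- For constant φ = c the choice Λ = N gives φ(Λ) + N/Λ = c + 1 for every N ≥ 1.
    refine ⟨C * (c + 1) + 1, by positivity, fun N hN => ?_⟩
    refine SmoothDisc.smoothDiscrepancy_le_ofReal fun γ ρ hρ hρ1 =>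
      (h γ ρ hρ hρ1 N hN N hN).trans ?_
    rw [div_self (by linarith)]
    linarith
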